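/- Let $p_1\le p_2$ and $q_1\le q_2$ be integers and let $H=(H_{nm})$, $K=(K_{nm})$, $n,m\in\mathbb Z$, be real band matrices of constant width: $H_{n,n+\sigma}=h_\sigma(n)$ for $\sigma\in[p_1,p_2]$ and $H_{n,n+\sigma}=0$ otherwise, with $h_{p_1}(n)\neq0\neq h_{p_2}(n)$ for all $n$; $K_{m+\sigma,m}=k_\sigma(m)$ for $\sigma\in[q_1,q_2]$ and $K_{m+\sigma,m}=0$ otherwise, with $k_{q_1}(m)\neq0\neq k_{q_2}(m)$ for all $m$. Consider, for $n\in\mathbb Z$, the generalized Toda field theory $$u_{n,xy}=F_n,\qquad F_n=\sum_m K_{nm}\exp\Big(\sum_l H_{ml}u_l\Big),$$ and the generalized Toda lattice $\ddot u_n=F_n$ obtained from it by reduction with respect to the translation $\partial_x-\partial_y$, that is, by $u_n(x,y)=u_n(t)$, $t=x+y$. Let $\rho_n$ be any solution of $\sum_{\sigma=p_1}^{p_2}h_\sigma(n)\rho_{n+\sigma}=1$ for all $n$, let $\psi^j$, $1\le j\le p_2-p_1$, be linearly independent solutions of $\sum_{\sigma=p_1}^{p_2}h_\sigma(n)\psi_{n+\sigma}=0$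 for all $n$, and let $\phi^l$, $1\le l\le q_2-q_1$, be linearly independent solutions of $\sum_{\sigma=q_1}^{q_2}k_\sigma(m)\phi_{m+\sigma}=0$ for all $m$. A Lie point symmetry is a vector field with smooth coefficients, depending on the independent variables and on all the fields $\{u_k\}$, whose second prolongation annihilates all the equations on their solution set. Formal sums over infinitely many sites are allowed in the coefficients. They are tested on jets in which, apart from the derivatives that the equations determine, only finitely many field values and derivatives are nonzero; the derivatives determined by the equations are eliminated exponential by exponential, i.e. coefficients $C_k$ of these derivatives contribute $\sum_m\big(\sum_k C_kK_{km}\big)\exp\big(\sum_l H_{ml}u_l\big)$, the sum over $m$ being required to converge unconditionally at each jet. Let $L_f$ be the symmetry algebra (a real vector space) of the field theory. The symmetry algebra of the lattice inherited from the field theory is the set of vector fields in $t$ and $\{u_n\}$ that are obtained by letting the elements of the normalizer $\{X\in L_f : [X,\partial_x-\partial_y]=\lambda(\partial_x-\partial_y),\ \lambda\in\mathbb R\}$ act on functions of $t=x+y$ and $\{u_n\}$. Then the vector fields $$P=\partial_t,\qquad D=t\,\partial_t-2\sum_n\rho_n\partial_{u_n},\qquad U_j=\sum_n\psi^j_n\partial_{u_n},\qquad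 W_j=t\sum_n\psi^j_n\partial_{u_n},$$ $$Z_{jl}=\Big(\sum_m\phi^l_mu_m\Big)\Big(\sum_n\psi^j_n\partial_{u_n}\Big),\qquad 1\le j\le p_2-p_1,\quad 1\le l\le q_2-q_1,$$ form a basis of the inherited symmetry algebra, and the inherited symmetry algebra coincides with the full Lie point symmetry algebra of the lattice. -/

import Mathlib

open scoped ContDiff

noncomputable section

namespace GenToda

/-! ### Vector fields in finitely many independent variables and infinitely many fields -/

/-- Values of the fields `u_k`, `k ∈ ℤ` (or of one of their derivatives) at one point. Jets are
tested on finitely supported values: a function of finitely many of the `u_k` is determined by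
them, and a formal sum `∑_m φ_m u_m` over all the sites makes sense on them. -/
abbrev Config := ℤ →₀ ℝ

/-- Functions of `p` independent variables and of all the fields. -/
abbrev Fun (p : ℕ) := (Fin p → ℝ) → Config → ℝ

/-- Vector fields `∑_i ξ^i(x,{u_k}) ∂_{x_i} + ∑_n φ_n(x,{u_k}) ∂_{u_n}`, as the pair `(ξ, φ)`.
The coefficients may depend on all the fields. -/
abbrev VF (p : ℕ) := (Fin p → Fun p) × (ℤ → Fun p)

/-- Smoothness, jointly in the independent variables and any finite number of the fields. -/
def SmoothFun {p : ℕ} (f : Fun p) : Prop :=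
  ∀ S : Finset ℤ, ContDiff ℝ ∞ (fun z : (Fin p → ℝ) × (S → ℝ) =>
    f z.1 (∑ k : S, Finsupp.single (k : ℤ) (z.2 k)))

/-- A vector field with smooth coefficients. -/
def SmoothVF {p : ℕ} (X : VF p) : Prop :=
  (∀ i, SmoothFun (X.1 i)) ∧ ∀ n, SmoothFun (X.2 n)

/-- The partial derivative `∂f/∂x_i`. -/
def partialX {p : ℕ} (i : Fin p) (f : Fun p) : Fun p :=
  fun x u => deriv (fun s : ℝ => f (x + s • Pi.single i (1 : ℝ)) u) 0

/-- The partial derivative `∂f/∂u_k`. -/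
def partialU {p : ℕ} (k : ℤ) (f : Fun p) : Fun p :=
  fun x u => deriv (fun s : ℝ => f x (u + Finsupp.single k s)) 0

/-- The action of a vector field on a function. (Below it is only used where the sum over the
sites has finitely many nonzero terms.) -/
def applyVF {p : ℕ} (X : VF p) (f : Fun p) : Fun p :=
  fun x u => (∑ i, X.1 i x u * partialX i f x u) + ∑ᶠ k : ℤ, X.2 k x u * partialU k f x u

/-- The commutator `[X, Y]`. -/
def bracket {p : ℕ} (X Y : VF p) : VF p :=
  (fun i => applyVF X (Y.1 i) - applyVF Y (X.1 i),
   fun n => applyVF X (Y.2 n) - applyVF Y (X.2 n))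

/-! ### Prolongation -/

/-- The total derivative `D_i f = ∂f/∂x_i + ∑_k u_{k,i} ∂f/∂u_k` of a function of `(x, u)`, at the
jet with first derivatives `u1 i k = u_{k,i}`, as the derivative of `f` along the line with this
velocity. -/
def totalD {p : ℕ} (i : Fin p) (f : Fun p) (x : Fin p → ℝ) (u : Config)
    (u1 : Fin p → Config) : ℝ :=
  deriv (fun s : ℝ => f (x + s • Pi.single i (1 : ℝ)) (u + s • u1 i)) 0

/-- The coefficient `φ_n^i = D_i φ_n - ∑_j u_{n,j} D_i ξ^j` of `∂_{u_{n,i}}` in the prolongation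
of `X`. -/
def prolong1 {p : ℕ} (X : VF p) (n : ℤ) (i : Fin p) (x : Fin p → ℝ) (u : Config)
    (u1 : Fin p → Config) : ℝ :=
  totalD i (X.2 n) x u u1 - ∑ j, u1 j n * totalD i (X.1 j) x u u1

/-- The coefficient `φ_n^{ij} = D_j φ_n^i - ∑_k u_{n,ik} D_j ξ^k` of `∂_{u_{n,ij}}` in the
prolongation of `X`, at the jet with second derivatives `u2 i j n = u_{n,ij}`. -/
def prolong2 {p : ℕ} (X : VF p) (n : ℤ) (i j : Fin p) (x : Fin p → ℝ) (u : Config)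
    (u1 : Fin p → Config) (u2 : Fin p → Fin p → Config) : ℝ :=
  deriv (fun s : ℝ => prolong1 X n i (x + s • Pi.single j (1 : ℝ)) (u + s • u1 j)
      (fun k => u1 k + s • u2 k j)) 0
    - ∑ k, u2 i k n * totalD j (X.1 k) x u u1

/-! ### The generalized Toda equations -/

/-- Matrices `H` and `K` on `ℤ × ℤ` with finite bands of constant width:
`H_{n,n+σ} = h_σ(n)` vanishes for `σ ∉ [p₁, p₂]`, `K_{m+σ,m} = k_σ(m)` vanishes for
`σ ∉ [q₁, q₂]`, and the outermost coefficients of the bands vanish nowhere. -/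
structure BandData where
  p₁ : ℤ
  p₂ : ℤ
  q₁ : ℤ
  q₂ : ℤ
  H : ℤ → ℤ → ℝ
  K : ℤ → ℤ → ℝ
  hp : p₁ ≤ p₂
  hq : q₁ ≤ q₂
  H_band : ∀ n σ, σ ∉ Set.Icc p₁ p₂ → H n (n + σ) = 0
  H_left : ∀ n, H n (n + p₁) ≠ 0
  H_right : ∀ n, H n (n + p₂) ≠ 0
  K_band : ∀ m σ, σ ∉ Set.Icc q₁ q₂ → K (m + σ) m = 0
  K_left : ∀ m, K (m + q₁) m ≠ 0
  K_right : ∀ m, K (m + q₂) m ≠ 0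

namespace BandData

variable (T : BandData)

/-- `∑_σ h_σ(n) ρ_{n+σ}`. -/
def opH (ρ : ℤ → ℝ) (n : ℤ) : ℝ :=
  ∑ σ ∈ Finset.Icc T.p₁ T.p₂, T.H n (n + σ) * ρ (n + σ)

/-- `∑_σ k_σ(m) φ_{m+σ}`. -/
def opK (φ : ℤ → ℝ) (m : ℤ) : ℝ :=
  ∑ σ ∈ Finset.Icc T.q₁ T.q₂, T.K (m + σ) m * φ (m + σ)

/-- The exponential `exp (∑_l H_{ml} u_l)`. -/
def E (m : ℤ) (u : ℤ → ℝ) : ℝ := Real.exp (T.opH u m)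

/-- The right-hand side `F_n = ∑_m K_{nm} exp (∑_l H_{ml} u_l)`. -/
def F (n : ℤ) (u : ℤ → ℝ) : ℝ :=
  ∑ m ∈ Finset.Icc (n - T.q₂) (n - T.q₁), T.K n m * T.E m u

/-- The column `(K_{nm})_n` of `K`, which has finite support. -/
def col (m : ℤ) : Config :=
  ∑ σ ∈ Finset.Icc T.q₁ T.q₂, Finsupp.single (m + σ) (T.K (m + σ) m)

/-- `Φ`, an affine function of the second derivatives `w = (w_n)`, takes the value `r` after the
substitution `w_n = F_n(u)` for all `n`. The vector `F(u)` is the sum over `m` of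
`exp (∑_l H_{ml} u_l)` times the `m`-th column of `K`; it has in general infinitely many nonzero
components, so the substitution is made exponential by exponential: the value is
`Φ(0) + ∑_m exp (∑_l H_{ml} u_l) (Φ(col m) - Φ(0))`. If `Φ` depends on finitely many `w_n`, only
finitely many terms are nonzero and this is the value at `w = F(u)`. -/
def OnShell (u : Config) (Φ : Config → ℝ) (r : ℝ) : Prop :=
  HasSum (fun m : ℤ => T.E m u * (Φ (T.col m) - Φ 0)) (r - Φ 0)

/-- `∑_m φ_m ∂F_n/∂u_m`, for the coefficients `φ_m` of the vector field `X`. -/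
def applyF {p : ℕ} (X : VF p) (n : ℤ) (x : Fin p → ℝ) (u : Config) : ℝ :=
  deriv (fun s : ℝ => T.F n (fun m => u m + s * X.2 m x u)) 0

/-- The Lie point symmetries of the generalized Toda field theory `u_{n,xy} = F_n`, `n ∈ ℤ`
(`x`, `y` are the variables `0`, `1`): the prolongation of the vector field annihilates
`u_{n,xy} - F_n` on the solution set, for all `n`. Here `a`, `b` are the values of `u_{xx}`,
`u_{yy}`, and `u1` those of `u_x`, `u_y`. -/
def fieldSymmetries : Set (VF 2) :=
  {X | SmoothVF X ∧ ∀ (n : ℤ) (x : Fin 2 → ℝ) (u : Config) (u1 : Fin 2 → Config) (a b : Config),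
    T.OnShell u (fun w => prolong2 X n 0 1 x u u1 ![![a, w], ![w, b]] - T.applyF X n x u) 0}

/-- The Lie point symmetries of the generalized Toda lattice `ü_n = F_n`, `n ∈ ℤ`: the
prolongation of the vector field annihilates `ü_n - F_n` on the solution set, for all `n`. -/
def latticeSymmetries : Set (VF 1) :=
  {v | SmoothVF v ∧ ∀ (n : ℤ) (t : Fin 1 → ℝ) (u : Config) (u1 : Fin 1 → Config),
    T.OnShell u (fun w => prolong2 v n 0 0 t u u1 (fun _ _ => w) - T.applyF v n t u) 0}

end BandData

/-! ### Reduction by `∂_x - ∂_y` -/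

/-- The vector field `∂_x - ∂_y`. -/
def translation : VF 2 := (![1, -1], 0)

/-- `X` maps the functions of `t = x + y` and `{u_k}` to such functions, and acts on them as `v`:
`X t = ξ + η` and `X u_n = φ_n` depend only on `t` and `{u_k}` and are the coefficients of `v`. -/
def ActsAs (X : VF 2) (v : VF 1) : Prop :=
  ∀ (x : Fin 2 → ℝ) (u : Config),
    X.1 0 x u + X.1 1 x u = v.1 0 (fun _ => x 0 + x 1) u ∧
    ∀ n, X.2 n x u = v.2 n (fun _ => x 0 + x 1) u

namespace BandData

variable (T : BandData)

/-- The normalizer `{X | [X, P] = c P, c ∈ ℝ}` of `P = ∂_x - ∂_y` in the symmetry algebra of the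
field theory. -/
def normalizer : Set (VF 2) :=
  {X | X ∈ T.fieldSymmetries ∧ ∃ c : ℝ, bracket X translation = c • translation}

/-- The symmetry algebra of the lattice inherited from the field theory: the action of the
normalizer on functions of `t` and `{u_k}`. -/
def inheritedSymmetries : Set (VF 1) :=
  {v | ∃ X ∈ T.normalizer, ActsAs X v}

end BandData

/-! ### The generators -/

/-- `P = ∂_t`. -/
def genP : VF 1 := (fun _ _ _ => 1, 0)

/-- `D = t ∂_t - 2 ∑_n ρ_n ∂_{u_n}`. -/
def genD (ρ : ℤ → ℝ) : VF 1 := (fun _ t _ => t 0, fun n _ _ => -2 * ρ n)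

/-- `U = ∑_n ψ_n ∂_{u_n}`. -/
def genU (ψ : ℤ → ℝ) : VF 1 := (0, fun n _ _ => ψ n)

/-- `W = t ∑_n ψ_n ∂_{u_n}`. -/
def genW (ψ : ℤ → ℝ) : VF 1 := (0, fun n t _ => t 0 * ψ n)

/-- `Z = (∑_m φ_m u_m) ∑_n ψ_n ∂_{u_n}`. -/
def genZ (ψ φ : ℤ → ℝ) : VF 1 := (0, fun n _ u => (u.sum fun m a => φ m * a) * ψ n)

/-- The family `P, D, U_j, W_j, Z_{jl}`. -/
def generators {r s : ℕ} (ρ : ℤ → ℝ) (ψ : Fin r → ℤ → ℝ) (φ : Fin s → ℤ → ℝ) :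
    (Unit ⊕ Unit) ⊕ (Fin r ⊕ Fin r) ⊕ (Fin r × Fin s) → VF 1 :=
  Sum.elim (Sum.elim (fun _ => genP) (fun _ => genD ρ))
    (Sum.elim (Sum.elim (fun j => genU (ψ j)) (fun j => genW (ψ j)))
      (fun jl => genZ (ψ jl.1) (φ jl.2)))

end GenToda

end

/-! Both algebras are compared with a third one: the affine fields (b + a t) ∂_t + ∑ (α_n + t β_n +
γ_n(u)) ∂_{u_n} with Hα = -2a, Hβ = 0, Hγ(u) = 0 and γ_n(column m of K) = 0. The inclusions
inherited ⊆ lattice ⊆ affine ⊆ inherited make all three equal, and the theory of linear recurrences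
identifies the affine fields with the span of the generators.

Lattice ⊆ affine is the main step (`lattice_eq_affineVF`). For a symmetry τ ∂_t + ∑ φ_n ∂_{u_n}, the
condition is split by degree in the velocities (`lattice_components`), which bounds the degree of τ
and φ_n in the fields. What remains is an identity between exponentials with coefficients affine in
the fields. For each m there is a direction in field space along which the m-th exponent differs
from zero and from all the others (`exists_separating`), and exponentials with affine coefficients
are independent, so the coefficient of each exponential can be read off. This shows that τ depends
on t only, and that ∂φ_n along column m equals K_{nm} (2τ' + (Hφ)_m) (`lattice_exp_coeff`). Since H
kills every field derivative of φ but not the column, Hφ = -2τ'. Then φ is constant along the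
columns, φ_tt = 0, and finally τ'' = 0.

Inherited ⊆ lattice: u_xx and u_yy are free in the field-theory condition, which forces the
coefficient of ∂_x to depend on x alone and that of ∂_y on y alone. The normalizer condition makes
them affine with a common slope, and the condition at u_x = u_y becomes the lattice one. Affine ⊆
inherited: an explicit lift is written down. -/

namespace GenToda

/-! ### Functions on a real vector space that are smooth on finite-dimensional affine subspaces -/

section FinSmooth

variable {V : Type*} [AddCommGroup V] [Module ℝ V]

/-- Smoothness along all finite-dimensional affine subspaces. -/
def FinSmooth (f : V → ℝ) : Prop :=
  ∀ (W : Type) [NormedAddCommGroup W] [NormedSpace ℝ W] [FiniteDimensional ℝ W]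
    (L : W →ₗ[ℝ] V) (z : V), ContDiff ℝ ∞ (fun s => f (z + L s))

/-- The linear map `(a, b) ↦ a v + b w`. -/
def planeMap (v w : V) : ℝ × ℝ →ₗ[ℝ] V :=
  (LinearMap.toSpanSingleton ℝ V v).coprod (LinearMap.toSpanSingleton ℝ V w)

theorem planeMap_apply (v w : V) (s : ℝ × ℝ) : planeMap v w s = s.1 • v + s.2 • w := by
  simp [planeMap]

namespace FinSmooth

variable {f g : V → ℝ}

/-- This reduces directional derivatives on `V`, which carries no topology, to Fréchet derivatives
on a finite-dimensional parameter space; additivity in the direction and symmetry of second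
derivatives are imported through it. -/
theorem fderiv_apply (hf : FinSmooth f) {W : Type} [NormedAddCommGroup W] [NormedSpace ℝ W]
    [FiniteDimensional ℝ W] (L : W →ₗ[ℝ] V) (z : V) (s t : W) :
    fderiv ℝ (fun s => f (z + L s)) s t = lineDeriv ℝ f (z + L s) (L t) := by
  have hd : DifferentiableAt ℝ (fun s => f (z + L s)) s :=
    ((hf W L z).differentiable (by simp)).differentiableAt
  rw [← hd.lineDeriv_eq_fderiv]
  simp [lineDeriv, add_assoc]

theorem lineDeriv_add_vec (hf : FinSmooth f) (z v w : V) :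
    lineDeriv ℝ f z (v + w) = lineDeriv ℝ f z v + lineDeriv ℝ f z w := by
  have h := fun t => hf.fderiv_apply (planeMap v w) z 0 t
  simp only [map_zero, add_zero, planeMap_apply] at h
  have h1 := h (1, 0)
  have h2 := h (0, 1)
  have h3 := h ((1, 0) + (0, 1))
  rw [map_add, h1, h2] at h3
  simpa using h3.symm

theorem hasDerivAt (hf : FinSmooth f) (z v : V) (s : ℝ) :
    HasDerivAt (fun s : ℝ => f (z + s • v)) (lineDeriv ℝ f (z + s • v) v) s := by
  have hd : DifferentiableAt ℝ (fun s : ℝ => f (z + LinearMap.toSpanSingleton ℝ V v s)) s :=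
    ((hf ℝ _ z).differentiable (by simp)).differentiableAt
  have h := hf.fderiv_apply (LinearMap.toSpanSingleton ℝ V v) z s 1
  have h' := hd.hasDerivAt
  rw [← fderiv_apply_one_eq_deriv, h] at h'
  simpa using h'

theorem hasDerivAt_zero (hf : FinSmooth f) (z v : V) :
    HasDerivAt (fun s : ℝ => f (z + s • v)) (lineDeriv ℝ f z v) 0 := by
  simpa using hf.hasDerivAt z v 0

theorem lineDeriv_smooth (hf : FinSmooth f) (v : V) : FinSmooth (fun z => lineDeriv ℝ f z v) := by
  intro W _ _ _ L z
  let M : W × ℝ →ₗ[ℝ] V := L.coprod (LinearMap.toSpanSingleton ℝ V v)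
  have h : (fun s => lineDeriv ℝ f (z + L s) v) =
      fun s : W => fderiv ℝ (fun s => f (z + M s)) (s, 0) (0, 1) := by
    funext s
    rw [hf.fderiv_apply]
    simp [M]
  rw [h]
  have h1 : ContDiff ℝ ∞ (fderiv ℝ (fun s => f (z + M s))) :=
    (hf _ M z).fderiv_right (by simp)
  exact (h1.comp (contDiff_id.prodMk contDiff_const)).clm_apply contDiff_const

theorem lineDeriv_comm (hf : FinSmooth f) (z v w : V) :
    lineDeriv ℝ (fun y => lineDeriv ℝ f y v) z w =
      lineDeriv ℝ (fun y => lineDeriv ℝ f y w) z v := by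
  set L := planeMap v w with hL
  set g : ℝ × ℝ → ℝ := fun s => f (z + L s) with hg
  have hgs : ContDiff ℝ ∞ g := hf _ L z
  have hd : ContDiff ℝ ∞ (fderiv ℝ g) := hgs.fderiv_right (by simp)
  have key : ∀ a b : ℝ × ℝ, fderiv ℝ (fderiv ℝ g) 0 b a =
      lineDeriv ℝ (fun y => lineDeriv ℝ f y (L a)) z (L b) := by
    intro a b
    have h1 := (hf.lineDeriv_smooth (L a)).fderiv_apply L z 0 b
    have h2 : (fun s => lineDeriv ℝ f (z + L s) (L a)) = fun s => fderiv ℝ g s a := by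
      funext s; rw [hg, hf.fderiv_apply]
    rw [h2] at h1
    rw [map_zero, add_zero] at h1
    rw [← h1]
    have hda : DifferentiableAt ℝ (fderiv ℝ g) 0 := (hd.differentiable (by simp)).differentiableAt
    rw [fderiv_clm_apply hda (differentiableAt_const _)]
    simp
  have hsym : IsSymmSndFDerivAt ℝ g 0 :=
    hgs.contDiffAt.isSymmSndFDerivAt (by
      simp only [minSmoothness_of_isRCLikeNormedField]; exact WithTop.coe_le_coe.2 (le_top (a := (2 : ℕ∞))))
  have h := hsym (0, 1) (1, 0)
  rw [key, key] at h
  simpa [hL, planeMap_apply] using h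

theorem add (hf : FinSmooth f) (hg : FinSmooth g) : FinSmooth (fun z => f z + g z) :=
  fun W _ _ _ L z => (hf W L z).add (hg W L z)

theorem const (c : ℝ) : FinSmooth (fun _ : V => c) := fun _ _ _ _ _ _ => contDiff_const

theorem linear (l : V →ₗ[ℝ] ℝ) : FinSmooth l := by
  intro W _ _ _ L z
  simp only [map_add]
  exact contDiff_const.add (LinearMap.toContinuousLinearMap (l.comp L)).contDiff

/-- A function with vanishing second derivative along a line is affine on it. -/
theorem eq_add_of_lineDeriv_lineDeriv_eq_zero (hf : FinSmooth f) (z v : V)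
    (h : ∀ s : ℝ, lineDeriv ℝ (fun y => lineDeriv ℝ f y v) (z + s • v) v = 0) (s : ℝ) :
    f (z + s • v) = f z + s * lineDeriv ℝ f z v := by
  have h1 : ∀ s : ℝ, lineDeriv ℝ f (z + s • v) v = lineDeriv ℝ f z v := by
    intro s
    have hd := fun s => (hf.lineDeriv_smooth v).hasDerivAt z v s
    have := is_const_of_deriv_eq_zero (f := fun s : ℝ => lineDeriv ℝ f (z + s • v) v)
      (fun s => (hd s).differentiableAt) (fun s => (hd s).deriv.trans (h s)) s 0
    simpa using this
  have hd : ∀ s : ℝ, HasDerivAt (fun s : ℝ => f (z + s • v) - s * lineDeriv ℝ f z v) 0 s := by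
    intro s
    have := (hf.hasDerivAt z v s).fun_sub ((hasDerivAt_id s).mul_const (lineDeriv ℝ f z v))
    simpa [h1 s] using this
  have := is_const_of_deriv_eq_zero (fun s => (hd s).differentiableAt) (fun s => (hd s).deriv) s 0
  simp at this
  linarith

theorem eq_of_lineDeriv_eq_zero (hf : FinSmooth f) (z v : V)
    (h : ∀ s : ℝ, lineDeriv ℝ f (z + s • v) v = 0) (s : ℝ) : f (z + s • v) = f z := by
  have hd := fun s => hf.hasDerivAt z v s
  have := is_const_of_deriv_eq_zero (f := fun s : ℝ => f (z + s • v))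
      (fun s => (hd s).differentiableAt) (fun s => (hd s).deriv.trans (h s)) s 0
  simpa using this

end FinSmooth

theorem lineDeriv_const_fun (c : ℝ) (z v : V) : lineDeriv ℝ (fun _ : V => c) z v = 0 := by
  simp [lineDeriv]

theorem lineDeriv_affine (c : ℝ) (l : V →ₗ[ℝ] ℝ) (z v : V) :
    lineDeriv ℝ (fun z => c + l z) z v = l v := by
  have : HasDerivAt (fun s : ℝ => c + l (z + s • v)) (l v) 0 := by
    simpa using (((hasDerivAt_id (0 : ℝ)).mul_const (l v)).const_add (l z)).const_add c
  exact this.deriv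

theorem lineDeriv_comp_linear {V' : Type*} [AddCommGroup V'] [Module ℝ V'] (π : V →ₗ[ℝ] V')
    (f : V' → ℝ) (z v : V) : lineDeriv ℝ (fun z => f (π z)) z v = lineDeriv ℝ f (π z) (π v) := by
  simp [lineDeriv]

end FinSmooth

/-! ### Smooth functions of the independent variables and the fields -/

section Fun

variable {p : ℕ}

/-- A function of the independent variables and the fields as a function on one vector space. -/
def uncurry (f : Fun p) : (Fin p → ℝ) × Config → ℝ := fun z => f z.1 z.2

theorem sum_single_of_support_subset {u : Config} {S : Finset ℤ} (h : u.support ⊆ S) :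
    ∑ k : S, Finsupp.single (k : ℤ) (u k) = u := by
  rw [Finset.sum_coe_sort S (fun k => Finsupp.single k (u k))]
  conv_rhs => rw [← Finsupp.sum_single u]
  exact (Finset.sum_subset h (by intro k _ hk; simpa using hk)).symm

/-- A finite-dimensional affine family of configurations is supported in one finite set of sites:
the support of the base point together with those of the images of a basis. On it `f` is a smooth
function of finitely many variables. -/
theorem SmoothFun.finSmooth {f : Fun p} (hf : SmoothFun f) : FinSmooth (uncurry f) := by
  intro W _ _ _ L z
  classical
  let b := Module.finBasis ℝ W
  let S : Finset ℤ := z.2.support ∪ Finset.univ.biUnion fun i => (L (b i)).2.support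
  let A : W →ₗ[ℝ] (Fin p → ℝ) × (S → ℝ) :=
    { toFun := fun s => ((L s).1, fun k => (L s).2 k)
      map_add' := by intro a b; ext <;> simp
      map_smul' := by intro a b; ext <;> simp }
  have hS : ∀ s, (z + L s).2.support ⊆ S := by
    intro s k hk
    by_contra hn
    simp only [S, Finset.mem_union, Finset.mem_biUnion, Finset.mem_univ, true_and, not_or,
      not_exists, Finsupp.mem_support_iff, not_not] at hn hk
    apply hk
    have e : L s = ∑ i, b.repr s i • L (b i) := by
      conv_lhs => rw [← b.sum_repr s]
      simp only [map_sum, map_smul]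
    rw [e]
    simp [Prod.snd_sum, hn.1, hn.2]
  have heq : (fun s => uncurry f (z + L s)) = fun s =>
      (fun y : (Fin p → ℝ) × (S → ℝ) => f y.1 (∑ k : S, Finsupp.single (k : ℤ) (y.2 k)))
        (((z.1, fun k => z.2 k) : (Fin p → ℝ) × (S → ℝ)) + A s) := by
    funext s
    have := sum_single_of_support_subset (hS s)
    simp only [uncurry]
    conv_lhs => rw [← this]
    rfl
  rw [heq]
  exact (hf S).comp (contDiff_const.add (LinearMap.toContinuousLinearMap A).contDiff)

theorem FinSmooth.smoothFun {f : Fun p} (hf : FinSmooth (uncurry f)) : SmoothFun f := by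
  intro S
  let L : (Fin p → ℝ) × (S → ℝ) →ₗ[ℝ] (Fin p → ℝ) × Config :=
    { toFun := fun y => (y.1, ∑ k : S, Finsupp.single (k : ℤ) (y.2 k))
      map_add' := by intro a b; ext <;> simp [Finset.sum_add_distrib]
      map_smul' := by 
        intro a b
        simp only [Prod.smul_snd, Pi.smul_apply, ← Finsupp.smul_single, ← Finset.smul_sum]
        rfl }
  have h := hf _ L 0
  simp only [zero_add] at h
  exact h

theorem totalD_eq (i : Fin p) (f : Fun p) (x : Fin p → ℝ) (u : Config) (u1 : Fin p → Config) :
    totalD i f x u u1 = lineDeriv ℝ (uncurry f) (x, u) (Pi.single i 1, u1 i) := rfl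

theorem partialX_eq (i : Fin p) (f : Fun p) (x : Fin p → ℝ) (u : Config) :
    partialX i f x u = lineDeriv ℝ (uncurry f) (x, u) (Pi.single i 1, 0) := by
  simp [partialX, lineDeriv, uncurry]

/-- The derivative of a total derivative along a prolonged line. -/
theorem hasDerivAt_totalD {f : Fun p} (hf : SmoothFun f) (i j : Fin p) (x : Fin p → ℝ)
    (u : Config) (u1 : Fin p → Config) (u2 : Fin p → Fin p → Config) :
    HasDerivAt (fun s : ℝ => totalD i f (x + s • Pi.single j (1 : ℝ)) (u + s • u1 j)
        (fun k => u1 k + s • u2 k j))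
      (lineDeriv ℝ (fun z => lineDeriv ℝ (uncurry f) z (Pi.single i 1, u1 i)) (x, u)
          (Pi.single j 1, u1 j) + lineDeriv ℝ (uncurry f) (x, u) (0, u2 i j)) 0 := by
  have hs := hf.finSmooth
  -- The direction of differentiation itself moves with s; linearity in the direction separates the
  -- fixed part from the part proportional to s.
  have heq : (fun s : ℝ => totalD i f (x + s • Pi.single j (1 : ℝ)) (u + s • u1 j)
        (fun k => u1 k + s • u2 k j)) = fun s : ℝ =>
      lineDeriv ℝ (uncurry f) ((x, u) + s • (Pi.single j 1, u1 j)) (Pi.single i 1, u1 i) +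
      s * lineDeriv ℝ (uncurry f) ((x, u) + s • (Pi.single j 1, u1 j)) (0, u2 i j) := by
    funext s
    rw [totalD_eq]
    have : ((Pi.single i 1, u1 i + s • u2 i j) : (Fin p → ℝ) × Config) =
        (Pi.single i 1, u1 i) + s • (0, u2 i j) := by simp
    rw [this, hs.lineDeriv_add_vec, lineDeriv_smul]
    rfl
  rw [heq]
  have h1 := (hs.lineDeriv_smooth (Pi.single i 1, u1 i)).hasDerivAt_zero (x, u)
    (Pi.single j 1, u1 j)
  have h2 := (hs.lineDeriv_smooth (0, u2 i j)).hasDerivAt_zero (x, u) (Pi.single j 1, u1 j)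
  simpa using h1.fun_add ((hasDerivAt_id (0 : ℝ)).fun_mul h2)

theorem prolong2_eq {X : VF p} (hX : SmoothVF X) (n : ℤ) (i j : Fin p) (x : Fin p → ℝ)
    (u : Config) (u1 : Fin p → Config) (u2 : Fin p → Fin p → Config) :
    prolong2 X n i j x u u1 u2 =
      (lineDeriv ℝ (fun z => lineDeriv ℝ (uncurry (X.2 n)) z (Pi.single i 1, u1 i)) (x, u)
          (Pi.single j 1, u1 j) + lineDeriv ℝ (uncurry (X.2 n)) (x, u) (0, u2 i j))
      - ∑ k, (u2 k j n * lineDeriv ℝ (uncurry (X.1 k)) (x, u) (Pi.single i 1, u1 i) +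
          u1 k n * (lineDeriv ℝ (fun z => lineDeriv ℝ (uncurry (X.1 k)) z (Pi.single i 1, u1 i))
            (x, u) (Pi.single j 1, u1 j) + lineDeriv ℝ (uncurry (X.1 k)) (x, u) (0, u2 i j)))
      - ∑ k, u2 i k n * lineDeriv ℝ (uncurry (X.1 k)) (x, u) (Pi.single j 1, u1 j) := by
  unfold prolong2 prolong1
  congr 1
  refine HasDerivAt.deriv ?_
  refine (hasDerivAt_totalD (hX.2 n) i j x u u1 u2).sub ?_
  refine HasDerivAt.fun_sum fun k _ => ?_
  have h1 : HasDerivAt (fun s : ℝ => (u1 k + s • u2 k j) n) (u2 k j n) 0 := by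
    simpa using ((hasDerivAt_id (0 : ℝ)).mul_const (u2 k j n)).const_add (u1 k n)
  have h2 := h1.fun_mul (hasDerivAt_totalD (hX.1 k) i j x u u1 u2)
  simpa [totalD_eq] using h2

end Fun

/-! ### Exponential polynomials -/

/-- Induction on the number of exponents. The operator g(s) ↦ g(s + 1) - exp(λ) g(s) lowers the
degree of the coefficient of exp(λ s), so applying it twice with λ = `lam i₁` removes that term. On
the term `i₀` it acts invertibly, because the exponents differ. -/
theorem exp_affine_coeff_eq_zero {ι : Type*} [DecidableEq ι] (i₀ : ι) (lam : ι → ℝ)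
    (J : Finset ι) (hi₀ : i₀ ∉ J) (hne : ∀ i ∈ J, lam i ≠ lam i₀) (a b : ι → ℝ)
    (h : ∀ s : ℝ, ∑ i ∈ insert i₀ J, Real.exp (lam i * s) * (a i + b i * s) = 0) :
    a i₀ = 0 ∧ b i₀ = 0 := by
  induction J using Finset.induction_on generalizing a b with
  | empty =>
    simp only [insert_empty_eq, Finset.sum_singleton, mul_eq_zero, Real.exp_ne_zero,
      false_or] at h
    have h0 := h 0
    have h1 := h 1
    constructor <;> linarith
  | insert i₁ J hi₁ ih =>
    have shift : ∀ a b : ι → ℝ,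
        (∀ s : ℝ, ∑ i ∈ insert i₀ (insert i₁ J), Real.exp (lam i * s) * (a i + b i * s) = 0) →
        ∀ s : ℝ, ∑ i ∈ insert i₀ (insert i₁ J), Real.exp (lam i * s) *
          (((Real.exp (lam i) - Real.exp (lam i₁)) * a i + Real.exp (lam i) * b i) +
            ((Real.exp (lam i) - Real.exp (lam i₁)) * b i) * s) = 0 := by
      intro a b h s
      have e1 := h (s + 1)
      have e2 := h s
      have e3 : ∑ i ∈ insert i₀ (insert i₁ J), (Real.exp (lam i * (s + 1)) * (a i + b i * (s + 1))
          - Real.exp (lam i₁) * (Real.exp (lam i * s) * (a i + b i * s))) = 0 := by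
        rw [Finset.sum_sub_distrib, ← Finset.mul_sum, e1, e2]; simp
      rw [← e3]
      refine Finset.sum_congr rfl fun i _ => ?_
      rw [mul_add (lam i), Real.exp_add, mul_one]
      ring
    have h2 := shift _ _ (shift a b h)
    have hsub : i₀ ∉ J ∧ i₀ ≠ i₁ := by
      simp only [Finset.mem_insert, not_or] at hi₀
      exact ⟨hi₀.2, hi₀.1⟩
    have h3 := ih hsub.1 (fun i hi => hne i (Finset.mem_insert_of_mem hi)) _ _ (fun s => by
      have := h2 s
      rw [Finset.insert_comm, Finset.sum_insert (by simp [hsub.2.symm, hi₁])] at this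
      simpa using this)
    have hd : Real.exp (lam i₀) - Real.exp (lam i₁) ≠ 0 := fun h =>
      hne i₁ (Finset.mem_insert_self _ _) (Real.exp_injective (sub_eq_zero.1 h)).symm
    obtain ⟨ha, hb⟩ := h3
    have hb0 : b i₀ = 0 := by simpa [hd] using hb
    rw [hb0] at ha
    exact ⟨by simpa [hd] using ha, hb0⟩

theorem exp_affine_coeff_eq_zero_of_eq_affine (J : Finset ℤ) (lam a b : ℤ → ℝ) (α β : ℝ)
    (m₀ : ℤ) (hm₀ : m₀ ∈ J) (h0 : lam m₀ ≠ 0) (hne : ∀ m, m ≠ m₀ → lam m ≠ lam m₀)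
    (h : ∀ s : ℝ, ∑ m ∈ J, Real.exp (lam m * s) * (a m + b m * s) = α + β * s) :
    a m₀ = 0 ∧ b m₀ = 0 := by
  classical
  -- The affine right-hand side is moved to the left as one more term, of exponent 0, carried by the
  -- index `none`.
  have := exp_affine_coeff_eq_zero (some m₀) (fun o => o.elim 0 lam)
    ((Finset.insertNone J).erase (some m₀)) (by simp)
    (by
      rintro (_ | m) hm
      · exact h0.symm
      · simp only [Finset.mem_erase, ne_eq, Option.some.injEq] at hm
        exact hne m hm.1)
    (fun o => o.elim (-α) a) (fun o => o.elim (-β) b)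
    (by
      intro s
      rw [Finset.insert_erase (by simpa using hm₀), Finset.sum_insertNone]
      simp only [Option.elim_none, Option.elim_some, h s]
      simp
      ring)
  simpa using this

/-! ### Solutions of linear recurrences on `ℤ` -/

/-- The nonvanishing outer coefficients allow solving for the leftmost or the rightmost value, so a
window of b - a consecutive zeros grows by one site on each side at every step. -/
theorem eq_zero_of_recurrence {a b : ℤ} (hab : a ≤ b) {c : ℤ → ℤ → ℝ} (hl : ∀ n, c n a ≠ 0)
    (hr : ∀ n, c n b ≠ 0) {f : ℤ → ℝ} (hf : ∀ n, ∑ σ ∈ Finset.Icc a b, c n σ * f (n + σ) = 0)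
    (h0 : ∀ i, 0 ≤ i → i < b - a → f i = 0) : f = 0 := by
  have key : ∀ N : ℕ, ∀ i : ℤ, -(N : ℤ) ≤ i → i < b - a + N → f i = 0 := by
    intro N
    induction N with
    | zero => intro i hi hi'; exact h0 i (by simpa using hi) (by simpa using hi')
    | succ N ih =>
      intro i hi hi'
      push_cast at hi hi'
      rcases lt_or_ge i (-(N : ℤ)) with h1 | h1
      · have := hf (i - a)
        rw [Finset.sum_eq_single a] at this
        · simpa [hl] using this
        · intro σ hσ hne
          rw [Finset.mem_Icc] at hσ
          rw [ih _ (by omega) (by omega), mul_zero]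
        · simp [hab]
      · rcases lt_or_ge i (b - a + N) with h2 | h2
        · exact ih i h1 h2
        · have := hf (i - b)
          rw [Finset.sum_eq_single b] at this
          · simpa [hr] using this
          · intro σ hσ hne
            rw [Finset.mem_Icc] at hσ
            rw [ih _ (by omega) (by omega), mul_zero]
          · simp [hab]
  funext i
  exact key (i.natAbs + 1) i (by omega) (by omega)

/-- Restriction to b - a consecutive sites is injective on solutions, so the solution space has
dimension at most b - a and an independent family of that size spans it. -/
theorem exists_eq_sum_of_recurrence {a b : ℤ} (hab : a ≤ b) {c : ℤ → ℤ → ℝ}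
    (hl : ∀ n, c n a ≠ 0) (hr : ∀ n, c n b ≠ 0) {ψ : Fin (b - a).toNat → ℤ → ℝ}
    (hψ : ∀ j n, ∑ σ ∈ Finset.Icc a b, c n σ * ψ j (n + σ) = 0) (hi : LinearIndependent ℝ ψ)
    {f : ℤ → ℝ} (hf : ∀ n, ∑ σ ∈ Finset.Icc a b, c n σ * f (n + σ) = 0) :
    ∃ x : Fin (b - a).toNat → ℝ, ∀ n, f n = ∑ j, x j * ψ j n := by
  let S : Submodule ℝ (ℤ → ℝ) :=
    { carrier := {f | ∀ n, ∑ σ ∈ Finset.Icc a b, c n σ * f (n + σ) = 0}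
      add_mem' := by
        intro f g hf hg n
        simp only [Pi.add_apply, mul_add, Finset.sum_add_distrib, hf n, hg n, add_zero]
      zero_mem' := by intro n; simp
      smul_mem' := by
        intro r f hf n
        simp only [Pi.smul_apply, smul_eq_mul, mul_left_comm _ r, ← Finset.mul_sum, hf n,
          mul_zero] }
  let R : S →ₗ[ℝ] (Fin (b - a).toNat → ℝ) :=
    { toFun := fun f j => f.1 (j : ℕ)
      map_add' := fun _ _ => rfl
      map_smul' := fun _ _ => rfl }
  have hR : Function.Injective R := by
    rw [← LinearMap.ker_eq_bot, LinearMap.ker_eq_bot']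
    intro f hf
    apply Subtype.ext
    refine eq_zero_of_recurrence hab hl hr f.2 fun i hi hi' => ?_
    have := congrFun hf ⟨i.toNat, by omega⟩
    simpa [R, hi] using this
  have : FiniteDimensional ℝ S := FiniteDimensional.of_injective R hR
  let ψ' : Fin (b - a).toNat → S := fun j => ⟨ψ j, hψ j⟩
  have hi' : LinearIndependent ℝ ψ' := LinearIndependent.of_comp S.subtype hi
  have hcard : Fintype.card (Fin (b - a).toNat) = Module.finrank ℝ S := by
    refine le_antisymm hi'.fintype_card_le_finrank ?_
    have := LinearMap.finrank_le_finrank_of_injective hR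
    simpa using this
  have hspan := hi'.span_eq_top_of_card_eq_finrank' hcard
  have hmem : (⟨f, hf⟩ : S) ∈ Submodule.span ℝ (Set.range ψ') := by rw [hspan]; trivial
  obtain ⟨x, hx⟩ := (Submodule.mem_span_range_iff_exists_fun ℝ).1 hmem
  refine ⟨x, fun n => ?_⟩
  have := congrFun (congrArg Subtype.val hx) n
  simpa [ψ', Finset.sum_apply] using this.symm

namespace BandData

variable (T : BandData)

/-! ### The band matrices -/

theorem H_eq_zero {m k : ℤ} (h : k < m + T.p₁ ∨ m + T.p₂ < k) : T.H m k = 0 := by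
  have := T.H_band m (k - m) (by rw [Set.mem_Icc]; omega)
  simpa using this

theorem K_eq_zero {n m : ℤ} (h : n < m + T.q₁ ∨ m + T.q₂ < n) : T.K n m = 0 := by
  have := T.K_band m (n - m) (by rw [Set.mem_Icc]; omega)
  simpa using this

theorem K_right' (n : ℤ) : T.K n (n - T.q₂) ≠ 0 := by
  simpa using T.K_right (n - T.q₂)

theorem opH_add (u v : ℤ → ℝ) (m : ℤ) : T.opH (u + v) m = T.opH u m + T.opH v m := by
  simp [opH, mul_add, Finset.sum_add_distrib]

theorem opH_smul (c : ℝ) (u : ℤ → ℝ) (m : ℤ) : T.opH (c • u) m = c * T.opH u m := by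
  simp [opH, Finset.mul_sum, mul_left_comm]

theorem opH_sum {ι : Type*} (s : Finset ι) (f : ι → ℤ → ℝ) (m : ℤ) :
    T.opH (fun n => ∑ i ∈ s, f i n) m = ∑ i ∈ s, T.opH (f i) m := by
  simp only [opH, Finset.mul_sum]
  rw [Finset.sum_comm]

theorem opH_single (m k : ℤ) (a : ℝ) : T.opH (Finsupp.single k a) m = T.H m k * a := by
  unfold opH
  by_cases h : k - m ∈ Finset.Icc T.p₁ T.p₂
  · rw [Finset.sum_eq_single_of_mem _ h]
    · simp
    · intro σ _ hne
      rw [Finsupp.single_eq_of_ne (by omega), mul_zero]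
  · rw [Finset.sum_eq_zero, T.H_eq_zero, zero_mul]
    · rw [Finset.mem_Icc] at h; omega
    · intro σ hσ
      rw [Finsupp.single_eq_of_ne, mul_zero]
      rintro rfl
      simp at h hσ
      omega

theorem opH_eq_zero_of_notMem {u : Config} {m : ℤ}
    (h : ∀ k ∈ u.support, k < m + T.p₁ ∨ m + T.p₂ < k) : T.opH u m = 0 := by
  refine Finset.sum_eq_zero fun σ hσ => ?_
  by_cases hu : u (m + σ) = 0
  · rw [hu, mul_zero]
  · rw [T.H_eq_zero (h _ (Finsupp.mem_support_iff.2 hu)), zero_mul]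

/-- Outside a finite set of rows, `H` annihilates a finitely supported vector. -/
theorem exists_finset_opH_eq_zero (u : Config) : ∃ J : Finset ℤ, ∀ m ∉ J, T.opH u m = 0 := by
  classical
  refine ⟨u.support.biUnion fun k => Finset.Icc (k - T.p₂) (k - T.p₁), fun m hm => ?_⟩
  refine T.opH_eq_zero_of_notMem fun k hk => ?_
  simp only [Finset.mem_biUnion, not_exists, not_and, Finset.mem_Icc] at hm
  have := hm k hk
  omega

theorem col_apply (m n : ℤ) : T.col m n = T.K n m := by
  unfold col
  rw [Finsupp.finsetSum_apply]
  by_cases h : n - m ∈ Finset.Icc T.q₁ T.q₂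
  · rw [Finset.sum_eq_single_of_mem _ h]
    · simp
    · intro σ _ hne
      rw [Finsupp.single_eq_of_ne (by omega)]
  · rw [Finset.sum_eq_zero, T.K_eq_zero]
    · rw [Finset.mem_Icc] at h; omega
    · intro σ hσ
      rw [Finsupp.single_eq_of_ne]
      rintro rfl
      simp at h hσ
      omega

theorem linear_col (γ : Config →ₗ[ℝ] ℝ) (m : ℤ) :
    γ (T.col m) = T.opK (fun k => γ (Finsupp.single k 1)) m := by
  unfold col opK
  rw [map_sum]
  refine Finset.sum_congr rfl fun σ _ => ?_
  rw [← smul_eq_mul, ← map_smul, Finsupp.smul_single, smul_eq_mul, mul_one]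

/-- For every column of `K` there is a row of `H` whose product with it is nonzero. -/
theorem opH_col_ne_zero (m : ℤ) : T.opH (T.col m) (m + T.q₂ - T.p₁) ≠ 0 := by
  unfold opH
  -- The row m + q₂ - p₁ of H starts at site m + q₂, exactly where column m of K ends, so the
  -- product has a single term.
  rw [Finset.sum_eq_single T.p₁]
  · have h1 := T.H_left (m + T.q₂ - T.p₁)
    have h2 := T.K_right m
    rw [col_apply]
    simp only [sub_add_cancel] at h1 ⊢
    exact mul_ne_zero h1 h2
  · intro σ hσ hne
    rw [Finset.mem_Icc] at hσ
    rw [col_apply, T.K_eq_zero (by omega), mul_zero]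
  · simp [T.hp]

/-- A direction in which the `m₀`-th exponential has an exponent different from all the others. -/
theorem exists_separating (m₀ : ℤ) :
    ∃ q : Config, T.opH q m₀ ≠ 0 ∧ ∀ m, m ≠ m₀ → T.opH q m ≠ T.opH q m₀ := by
  have hs : ∀ A B : ℝ, (A ≠ 0 ∨ B ≠ 0) → {β : ℝ | A + β * B = 0}.Subsingleton := by
    intro A B h x hx y hy
    simp only [Set.mem_ofPred_eq] at hx hy
    by_cases hB : B = 0
    · simp [hB] at hx h; exact absurd hx h
    · have : (x - y) * B = 0 := by linarith
      rcases mul_eq_zero.1 this with h | h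
      · linarith
      · exact absurd h hB
  let e₁ : Config := Finsupp.single (m₀ + T.p₁) (T.H m₀ (m₀ + T.p₁))⁻¹
  let e₂ : Config := Finsupp.single (m₀ + T.p₂) 1
  have h11 : T.opH e₁ m₀ = 1 := by
    rw [opH_single]; exact mul_inv_cancel₀ (T.H_left m₀)
  have h22 : T.opH e₂ m₀ ≠ 0 := by
    rw [opH_single, mul_one]; exact T.H_right m₀
  have hq : ∀ (β : ℝ) (m : ℤ), T.opH (e₁ + β • e₂ : Config) m = T.opH e₁ m + β * T.opH e₂ m := by
    intro β m
    rw [Finsupp.coe_add, Finsupp.coe_smul, opH_add, opH_smul]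
  -- Each unwanted coincidence excludes at most one β: rows below m₀ do not meet the site of `e₂`,
  -- rows above m₀ do not meet that of `e₁`. Countably many exclusions leave some real β.
  have hc : ({β : ℝ | T.opH e₁ m₀ + β * T.opH e₂ m₀ = 0} ∪ ⋃ m : {m : ℤ // m ≠ m₀},
      {β : ℝ | (T.opH e₁ m - T.opH e₁ m₀) + β * (T.opH e₂ m - T.opH e₂ m₀) = 0}).Countable := by
    refine Set.Countable.union (hs _ _ (Or.inr h22)).countable (Set.countable_iUnion ?_)
    rintro ⟨m, hm⟩
    refine (hs _ _ ?_).countable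
    rcases lt_or_gt_of_ne hm with h | h
    · right
      rw [opH_single T m, T.H_eq_zero (by omega), zero_mul, zero_sub]
      exact neg_ne_zero.2 h22
    · left
      rw [opH_single T m, T.H_eq_zero (by omega), h11]
      norm_num
  obtain ⟨β, hβ⟩ : ∃ β : ℝ, β ∉ _ := by
    by_contra! hall
    exact Set.not_countable_univ (hc.mono fun β _ => hall β)
  simp only [Set.mem_union, Set.mem_ofPred_eq, Set.mem_iUnion, not_or, not_exists,
    Subtype.forall] at hβ
  refine ⟨e₁ + β • e₂, by rw [hq]; exact hβ.1, fun m hm h => hβ.2 m hm ?_⟩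
  rw [hq, hq] at h
  linarith

/-! ### The exponentials and the right-hand sides -/

theorem E_pos (m : ℤ) (u : ℤ → ℝ) : 0 < T.E m u := Real.exp_pos _

theorem E_add_smul (m : ℤ) (u v : Config) (s : ℝ) :
    T.E m (u + s • v : Config) = T.E m u * Real.exp (T.opH v m * s) := by
  unfold E
  rw [Finsupp.coe_add, Finsupp.coe_smul, opH_add, opH_smul, Real.exp_add, mul_comm s]

theorem K_eq_zero_of_notMem {n m : ℤ} (h : m ∉ Finset.Icc (n - T.q₂) (n - T.q₁)) :
    T.K n m = 0 := by
  rw [Finset.mem_Icc] at h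
  exact T.K_eq_zero (by omega)

theorem hasSum_K_mul (n : ℤ) (g : ℤ → ℝ) :
    HasSum (fun m => T.K n m * g m)
      (∑ m ∈ Finset.Icc (n - T.q₂) (n - T.q₁), T.K n m * g m) :=
  hasSum_sum_of_ne_finset_zero fun m hm => by rw [T.K_eq_zero_of_notMem hm, zero_mul]

theorem applyF_eq {p : ℕ} (X : VF p) (n : ℤ) (x : Fin p → ℝ) (u : Config) :
    T.applyF X n x u = ∑ m ∈ Finset.Icc (n - T.q₂) (n - T.q₁),
      T.K n m * (T.E m u * T.opH (fun k => X.2 k x u) m) := by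
  unfold applyF F
  refine HasDerivAt.deriv (HasDerivAt.fun_sum fun m _ => HasDerivAt.const_mul _ ?_)
  have h : HasDerivAt (fun s : ℝ => T.opH u m + s * T.opH (fun k => X.2 k x u) m)
      (T.opH (fun k => X.2 k x u) m) 0 := by
    simpa using ((hasDerivAt_id (0 : ℝ)).mul_const
      (T.opH (fun k => X.2 k x u) m)).const_add (T.opH u m)
  have h' := h.exp
  have e : (fun s : ℝ => T.E m fun k => u k + s * X.2 k x u) = fun s : ℝ =>
      Real.exp (T.opH u m + s * T.opH (fun k => X.2 k x u) m) := by
    funext s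
    rw [← opH_smul, ← opH_add]
    rfl
  rw [e]
  simpa [E] using h'

end BandData

/-! ### Iterated directional derivatives -/

section Dir

variable {V : Type*} [AddCommGroup V] [Module ℝ V]

/-- The derivative of a function in the direction `v`, as a function of the point. -/
noncomputable def dir (v : V) (f : V → ℝ) : V → ℝ := fun z => lineDeriv ℝ f z v

variable {f g : V → ℝ}

theorem dir_add_fun (hf : FinSmooth f) (hg : FinSmooth g) (v : V) :
    dir v (f + g) = dir v f + dir v g := by
  funext z
  exact ((hf.hasDerivAt_zero z v).fun_add (hg.hasDerivAt_zero z v)).deriv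

theorem dir_smul_fun (c : ℝ) (v : V) (f : V → ℝ) : dir v (c • f) = c • dir v f := by
  funext z
  simp [dir, lineDeriv, deriv_const_mul_field]

theorem dir_const (v : V) (c : ℝ) : dir v (fun _ => c) = 0 :=
  funext fun z => lineDeriv_const_fun c z v

theorem dir_zero_fun (v : V) : dir v (0 : V → ℝ) = 0 := dir_const v 0

theorem dir_zero (f : V → ℝ) : dir (0 : V) f = 0 := by
  funext z; exact lineDeriv_zero

theorem dir_smul (c : ℝ) (v : V) (f : V → ℝ) : dir (c • v) f = c • dir v f := by
  funext z
  simp [dir, lineDeriv_smul]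

namespace FinSmooth

theorem dir (hf : FinSmooth f) (v : V) : FinSmooth (dir v f) := hf.lineDeriv_smooth v

theorem dir_add (hf : FinSmooth f) (v w : V) :
    GenToda.dir (v + w) f = GenToda.dir v f + GenToda.dir w f :=
  funext fun z => hf.lineDeriv_add_vec z v w

theorem dir_comm (hf : FinSmooth f) (v w : V) :
    GenToda.dir v (GenToda.dir w f) = GenToda.dir w (GenToda.dir v f) :=
  funext fun z => hf.lineDeriv_comm z w v

theorem dir_dir_add (hf : FinSmooth f) (v w : V) :
    GenToda.dir (v + w) (GenToda.dir (v + w) f) =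
      GenToda.dir v (GenToda.dir v f) + (2 : ℝ) • GenToda.dir v (GenToda.dir w f) +
        GenToda.dir w (GenToda.dir w f) := by
  rw [hf.dir_add v w, dir_add_fun (hf.dir v) (hf.dir w), (hf.dir v).dir_add, (hf.dir w).dir_add,
    hf.dir_comm w v, two_smul]
  abel

/-- Polarization of the symmetric second derivative. -/
theorem dir_dir_eq_zero_of_forall (hf : FinSmooth f) {v w : V}
    (hv : GenToda.dir v (GenToda.dir v f) = 0) (hw : GenToda.dir w (GenToda.dir w f) = 0)
    (hvw : GenToda.dir (v + w) (GenToda.dir (v + w) f) = 0) :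
    GenToda.dir v (GenToda.dir w f) = 0 := by
  rw [hf.dir_dir_add, hv, hw, zero_add, add_zero] at hvw
  simpa using hvw

theorem eq_add_of_dir_dir_eq_zero (hf : FinSmooth f) {v : V}
    (h : GenToda.dir v (GenToda.dir v f) = 0) (z : V) (s : ℝ) :
    f (z + s • v) = f z + s * GenToda.dir v f z :=
  hf.eq_add_of_lineDeriv_lineDeriv_eq_zero z v (fun _ => congrFun h _) s

theorem eq_of_dir_eq_zero (hf : FinSmooth f) {v : V} (h : GenToda.dir v f = 0) (z : V) (s : ℝ) :
    f (z + s • v) = f z :=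
  hf.eq_of_lineDeriv_eq_zero z v (fun _ => congrFun h _) s

end FinSmooth

end Dir

theorem hasSum_of_eq {f g : ℤ → ℝ} {a b : ℝ} (h : HasSum f a) (hfg : ∀ m, f m = g m)
    (hab : a = b) : HasSum g b := by
  rwa [← funext hfg, ← hab]

/-! ### The affine vector fields in `t` and `{u_n}` -/

/-- The vector field `(b + a t) ∂_t + ∑_n (α_n + t β_n + γ_n(u)) ∂_{u_n}`. -/
noncomputable def affineVF (b a : ℝ) (α β : ℤ → ℝ) (γ : ℤ → Config →ₗ[ℝ] ℝ) : VF 1 :=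
  (fun _ t _ => b + a * t 0, fun n t u => α n + t 0 * β n + γ n u)

namespace BandData

variable (T : BandData)

/-- The linear conditions on the coefficients of an affine vector field which make it a symmetry
of the lattice. -/
structure IsCompatible (a : ℝ) (α β : ℤ → ℝ) (γ : ℤ → Config →ₗ[ℝ] ℝ) : Prop where
  opH_const : ∀ m, T.opH α m = -2 * a
  opH_slope : ∀ m, T.opH β m = 0
  opH_linear : ∀ u m, T.opH (fun n => γ n u) m = 0
  linear_col : ∀ n m, γ n (T.col m) = 0

/-! ### Symmetries of the lattice are affine -/

section Lattice

/-- The direction of the independent variable. -/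
noncomputable def timeDir : (Fin 1 → ℝ) × Config := (Pi.single 0 1, 0)

/-- A direction in the space of fields. -/
noncomputable def fieldDir (q : Config) : (Fin 1 → ℝ) × Config := (0, q)

theorem fieldDir_add (p q : Config) : fieldDir (p + q) = fieldDir p + fieldDir q := by
  simp [fieldDir]

theorem fieldDir_smul (c : ℝ) (q : Config) : fieldDir (c • q) = c • fieldDir q := by
  simp [fieldDir]

theorem timeDir_add_fieldDir (q : Config) : timeDir + fieldDir q = (Pi.single 0 1, q) := by
  simp [timeDir, fieldDir]

variable {T} {v : VF 1}

/-- The part of the condition free of second derivatives is collected as the value of the sum; the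
difference between `T.col m` and 0 leaves in the summand only the terms linear in the second
derivatives. -/
theorem onShell_lattice_iff (hv : SmoothVF v) (n : ℤ) (t : Fin 1 → ℝ) (u q : Config) :
    T.OnShell u (fun w => prolong2 v n 0 0 t u (fun _ => q) (fun _ _ => w) - T.applyF v n t u) 0 ↔
    HasSum (fun m => T.E m u * (dir (fieldDir (T.col m)) (uncurry (v.2 n)) (t, u)
        - 2 * T.K n m * dir (timeDir + fieldDir q) (uncurry (v.1 0)) (t, u)
        - q n * dir (fieldDir (T.col m)) (uncurry (v.1 0)) (t, u)))
      (T.applyF v n t u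
        - dir (timeDir + fieldDir q) (dir (timeDir + fieldDir q) (uncurry (v.2 n))) (t, u)
        + q n * dir (timeDir + fieldDir q)
          (dir (timeDir + fieldDir q) (uncurry (v.1 0))) (t, u)) := by
  unfold OnShell
  simp only [prolong2_eq hv, Finset.univ_unique, Finset.sum_singleton, Fin.default_eq_zero,
    Fin.isValue, col_apply, Finsupp.coe_zero, Pi.zero_apply, zero_mul]
  have h0 : ((0, 0) : (Fin 1 → ℝ) × Config) = 0 := rfl
  rw [h0]
  simp only [lineDeriv_zero, timeDir_add_fieldDir]
  unfold dir fieldDir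
  constructor <;> intro h <;> refine hasSum_of_eq h (fun m => ?_) ?_ <;> ring

theorem lattice_hasSum (hv : v ∈ T.latticeSymmetries) (n : ℤ) (z : (Fin 1 → ℝ) × Config)
    (q : Config) :
    HasSum (fun m => T.E m z.2 * (dir (fieldDir (T.col m)) (uncurry (v.2 n)) z
        - 2 * T.K n m * dir (timeDir + fieldDir q) (uncurry (v.1 0)) z
        - q n * dir (fieldDir (T.col m)) (uncurry (v.1 0)) z))
      (T.applyF v n z.1 z.2
        - dir (timeDir + fieldDir q) (dir (timeDir + fieldDir q) (uncurry (v.2 n))) z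
        + q n * dir (timeDir + fieldDir q) (dir (timeDir + fieldDir q) (uncurry (v.1 0))) z) :=
  (onShell_lattice_iff hv.1 n z.1 z.2 q).1 (hv.2 n z.1 z.2 (fun _ => q))

/-- The homogeneous components, in the first derivatives, of the symmetry condition. -/
theorem lattice_components (hv : v ∈ T.latticeSymmetries) (n : ℤ) (z : (Fin 1 → ℝ) × Config)
    (q : Config) :
    q n * dir (fieldDir q) (dir (fieldDir q) (uncurry (v.1 0))) z = 0 ∧
    dir (fieldDir q) (dir (fieldDir q) (uncurry (v.2 n))) z =
      2 * q n * dir timeDir (dir (fieldDir q) (uncurry (v.1 0))) z ∧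
    HasSum (fun m => T.E m z.2 * (-2 * T.K n m * dir (fieldDir q) (uncurry (v.1 0)) z
        - q n * dir (fieldDir (T.col m)) (uncurry (v.1 0)) z))
      (q n * dir timeDir (dir timeDir (uncurry (v.1 0))) z
        - 2 * dir timeDir (dir (fieldDir q) (uncurry (v.2 n))) z) := by
  have hτ := (hv.1.1 0).finSmooth
  have hf := (hv.1.2 n).finSmooth
  -- The condition at velocity c q minus the one at velocity 0: the summand is linear in c, the
  -- value is a cubic polynomial without constant term.
  have key : ∀ c : ℝ, HasSum (fun m => c * (T.E m z.2 *
      (-2 * T.K n m * dir (fieldDir q) (uncurry (v.1 0)) z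
        - q n * dir (fieldDir (T.col m)) (uncurry (v.1 0)) z)))
      (- (2 * c * dir timeDir (dir (fieldDir q) (uncurry (v.2 n))) z
          + c ^ 2 * dir (fieldDir q) (dir (fieldDir q) (uncurry (v.2 n))) z)
        + c * q n * (dir timeDir (dir timeDir (uncurry (v.1 0))) z
          + 2 * c * dir timeDir (dir (fieldDir q) (uncurry (v.1 0))) z
          + c ^ 2 * dir (fieldDir q) (dir (fieldDir q) (uncurry (v.1 0))) z)) := by
    intro c
    have h0 := lattice_hasSum hv n z 0
    have hc := lattice_hasSum hv n z (c • q)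
    have hz : fieldDir 0 = 0 := rfl
    rw [hz, add_zero] at h0
    rw [hf.dir_dir_add, hτ.dir_dir_add] at hc
    simp only [hτ.dir_add, fieldDir_smul, dir_smul, dir_smul_fun] at hc
    refine hasSum_of_eq (hc.sub h0) (fun m => ?_) ?_
    · simp only [Pi.add_apply, Pi.smul_apply, smul_eq_mul, Finsupp.coe_smul, Finsupp.coe_zero,
        Pi.zero_apply]
      ring
    · simp only [Pi.add_apply, Pi.smul_apply, smul_eq_mul, Finsupp.coe_smul, Finsupp.coe_zero,
        Pi.zero_apply]
      ring
  -- The value must equal c times its value at 1; c = -1 and c = 2 isolate the quadratic and cubic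
  -- parts.
  have two : ∀ c : ℝ, _ := fun c => (key c).unique ((key 1).mul_left c |> fun h =>
    hasSum_of_eq h (fun m => by rw [one_mul]) rfl)
  have e1 := two (-1)
  have e2 := two 2
  have hcub : q n * dir (fieldDir q) (dir (fieldDir q) (uncurry (v.1 0))) z = 0 := by linarith
  have hsq : dir (fieldDir q) (dir (fieldDir q) (uncurry (v.2 n))) z =
      2 * q n * dir timeDir (dir (fieldDir q) (uncurry (v.1 0))) z := by linarith
  refine ⟨hcub, hsq, hasSum_of_eq (key 1) (fun m => one_mul _) ?_⟩
  linear_combination hcub - hsq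

theorem lattice_dir_dir_time_coeff (hv : v ∈ T.latticeSymmetries) (q : Config) :
    dir (fieldDir q) (dir (fieldDir q) (uncurry (v.1 0))) = 0 := by
  funext z
  by_cases hq : q = 0
  · subst hq
    have hz : fieldDir 0 = 0 := rfl
    rw [hz, dir_zero]
  · obtain ⟨n, hn⟩ := Finsupp.ne_iff.1 hq
    exact (mul_eq_zero.1 (lattice_components hv n z q).1).resolve_left (by simpa using hn)

theorem lattice_dir_dir_time_coeff' (hv : v ∈ T.latticeSymmetries) (p q : Config) :
    dir (fieldDir p) (dir (fieldDir q) (uncurry (v.1 0))) = 0 :=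
  (hv.1.1 0).finSmooth.dir_dir_eq_zero_of_forall (lattice_dir_dir_time_coeff hv p)
    (lattice_dir_dir_time_coeff hv q) (by rw [← fieldDir_add]; exact lattice_dir_dir_time_coeff hv _)

/-- The coefficient of `∂_t` does not depend on the fields. -/
theorem lattice_dir_time_coeff (hv : v ∈ T.latticeSymmetries) (p : Config) :
    dir (fieldDir p) (uncurry (v.1 0)) = 0 := by
  have hτ := (hv.1.1 0).finSmooth
  induction p using Finsupp.induction_linear with
  | zero => exact dir_zero _
  | add p q hp hq => rw [fieldDir_add, hτ.dir_add, hp, hq, add_zero]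
  | single k x =>
    set p : Config := Finsupp.single k x with hp
    -- At such a site the terms with the factor p_n drop out of the linear component, leaving F_n
    -- ∂_p τ = ∂_t ∂_p φ_n.
    obtain ⟨n, hn⟩ : ∃ n : ℤ, p n = 0 := ⟨k + 1, by rw [hp, Finsupp.single_eq_of_ne (by omega)]⟩
    have hf := (hv.1.2 n).finSmooth
    have hF : ∀ z, T.F n z.2 * dir (fieldDir p) (uncurry (v.1 0)) z =
        dir timeDir (dir (fieldDir p) (uncurry (v.2 n))) z := by
      intro z
      have h1 := (lattice_components hv n z p).2.2
      have h2 := (T.hasSum_K_mul n (fun m => T.E m z.2)).mul_left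
        (-2 * dir (fieldDir p) (uncurry (v.1 0)) z)
      have h3 := h1.unique (hasSum_of_eq h2 (fun m => by rw [hn]; ring) rfl)
      rw [hn] at h3
      unfold F
      linarith
    funext z
    -- Along q the factor ∂_p τ is constant and ∂_t ∂_p φ_n is affine, while F_n contains the
    -- exponential m = n - q₂ with nonzero coefficient; this forces ∂_p τ = 0.
    obtain ⟨q, hq0, hq⟩ := T.exists_separating (n - T.q₂)
    have hc : ∀ s : ℝ, dir (fieldDir p) (uncurry (v.1 0)) (z + s • fieldDir q) =
        dir (fieldDir p) (uncurry (v.1 0)) z := fun s =>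
      (hτ.dir _).eq_of_dir_eq_zero (lattice_dir_dir_time_coeff' hv q p) z s
    have hqq : dir (fieldDir q) (dir (fieldDir q) (uncurry (v.2 n))) =
        (2 * q n) • dir timeDir (dir (fieldDir q) (uncurry (v.1 0))) :=
      funext fun z => (lattice_components hv n z q).2.1
    have haff : dir (fieldDir q) (dir (fieldDir q)
        (dir timeDir (dir (fieldDir p) (uncurry (v.2 n))))) = 0 := by
      rw [(hf.dir _).dir_comm (fieldDir q) timeDir, hf.dir_comm (fieldDir q) (fieldDir p),
        ((hf.dir _).dir _).dir_comm (fieldDir q) timeDir, (hf.dir _).dir_comm (fieldDir q) _, hqq,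
        dir_smul_fun, dir_smul_fun, (hτ.dir _).dir_comm (fieldDir p) timeDir,
        lattice_dir_dir_time_coeff' hv p q, dir_zero_fun, dir_zero_fun, smul_zero]
    have hlin := ((hf.dir (fieldDir p)).dir timeDir).eq_add_of_dir_dir_eq_zero haff z
    set c := dir (fieldDir p) (uncurry (v.1 0)) z
    have hx := (exp_affine_coeff_eq_zero_of_eq_affine (Finset.Icc (n - T.q₂) (n - T.q₁))
      (fun m => T.opH q m) (fun m => T.K n m * T.E m z.2 * c) 0 _ _ (n - T.q₂)
      (by rw [Finset.mem_Icc]; have := T.hq; omega) hq0 hq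
      (fun s => by
        rw [mul_comm _ s, ← hlin s, ← hF, hc]
        unfold F
        rw [Finset.sum_mul]
        refine Finset.sum_congr rfl fun m _ => ?_
        have : (z + s • fieldDir q).2 = z.2 + s • q := rfl
        rw [this, E_add_smul]
        simp only [Pi.zero_apply]
        ring)).1
    simpa [T.K_right', (T.E_pos _ _).ne'] using hx

/-- The symmetry condition when the coefficient of `∂_t` depends on `t` only. -/
theorem lattice_hasSum_zero (hv : v ∈ T.latticeSymmetries) (n : ℤ) (z : (Fin 1 → ℝ) × Config) :
    HasSum (fun m => T.E m z.2 * (dir (fieldDir (T.col m)) (uncurry (v.2 n)) z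
        - 2 * T.K n m * dir timeDir (uncurry (v.1 0)) z))
      (T.applyF v n z.1 z.2 - dir timeDir (dir timeDir (uncurry (v.2 n))) z) := by
  have h := lattice_hasSum hv n z 0
  have hz : fieldDir 0 = 0 := rfl
  rw [hz, add_zero] at h
  exact hasSum_of_eq h (fun m => by simp) (by simp)

/-! ### The field coefficients of a lattice symmetry -/

theorem lattice_dir_dir_field_coeff (hv : v ∈ T.latticeSymmetries) (n : ℤ) (p q : Config) :
    dir (fieldDir p) (dir (fieldDir q) (uncurry (v.2 n))) = 0 := by
  have key : ∀ q, dir (fieldDir q) (dir (fieldDir q) (uncurry (v.2 n))) = 0 := by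
    intro q
    funext z
    rw [(lattice_components hv n z q).2.1, lattice_dir_time_coeff hv, dir_zero_fun]
    simp
  exact (hv.1.2 n).finSmooth.dir_dir_eq_zero_of_forall (key p) (key q)
    (by rw [← fieldDir_add]; exact key _)

theorem lattice_dir_time_dir_field_coeff (hv : v ∈ T.latticeSymmetries) (n : ℤ) (q : Config)
    (z : (Fin 1 → ℝ) × Config) :
    2 * dir timeDir (dir (fieldDir q) (uncurry (v.2 n))) z =
      q n * dir timeDir (dir timeDir (uncurry (v.1 0))) z := by
  have h := (lattice_components hv n z q).2.2
  simp only [lattice_dir_time_coeff hv, Pi.zero_apply, mul_zero, sub_zero] at h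
  have := h.unique hasSum_zero
  linarith

theorem lattice_field_coeff_add (hv : v ∈ T.latticeSymmetries) (n : ℤ)
    (z : (Fin 1 → ℝ) × Config) (q : Config) (s : ℝ) :
    uncurry (v.2 n) (z + s • fieldDir q) =
      uncurry (v.2 n) z + s * dir (fieldDir q) (uncurry (v.2 n)) z :=
  (hv.1.2 n).finSmooth.eq_add_of_dir_dir_eq_zero (lattice_dir_dir_field_coeff hv n q q) z s

theorem lattice_opH_add (hv : v ∈ T.latticeSymmetries) (m : ℤ)
    (z : (Fin 1 → ℝ) × Config) (q : Config) (s : ℝ) :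
    T.opH (fun n => uncurry (v.2 n) (z + s • fieldDir q)) m =
      T.opH (fun n => uncurry (v.2 n) z) m +
        s * T.opH (fun n => dir (fieldDir q) (uncurry (v.2 n)) z) m := by
  simp only [lattice_field_coeff_add hv]
  rw [← opH_smul, ← opH_add]
  rfl

/-- The coefficients of the `m`-th exponential in the symmetry condition. -/
theorem lattice_exp_coeff (hv : v ∈ T.latticeSymmetries) (n m₀ : ℤ)
    (z : (Fin 1 → ℝ) × Config) :
    dir (fieldDir (T.col m₀)) (uncurry (v.2 n)) z
        - 2 * T.K n m₀ * dir timeDir (uncurry (v.1 0)) z =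
      T.K n m₀ * T.opH (fun k => uncurry (v.2 k) z) m₀ := by
  classical
  have hτ := (hv.1.1 0).finSmooth
  have hf := (hv.1.2 n).finSmooth
  obtain ⟨q, hq0, hq⟩ := T.exists_separating m₀
  obtain ⟨J₀, hJ₀⟩ := T.exists_finset_opH_eq_zero q
  set I := Finset.Icc (n - T.q₂) (n - T.q₁) with hI
  set J := J₀ ∪ I with hJ
  have hm₀ : m₀ ∈ J := by
    by_contra h
    exact hq0 (hJ₀ _ fun h' => h (Finset.mem_union_left _ h'))
  set a : ℤ → ℝ := fun m => dir (fieldDir (T.col m)) (uncurry (v.2 n)) z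
        - 2 * T.K n m * dir timeDir (uncurry (v.1 0)) z with ha
  set A : ℤ → ℝ := fun m => T.opH (fun k => uncurry (v.2 k) z) m with hA
  set B : ℤ → ℝ := fun m => T.opH (fun k => dir (fieldDir q) (uncurry (v.2 k)) z) m with hB
  have hz : ∀ s : ℝ, (z + s • fieldDir q).2 = z.2 + s • q := fun s => rfl
  have hline : ∀ s : ℝ, HasSum (fun m => T.E m z.2 * Real.exp (T.opH q m * s) * a m)
      (∑ m ∈ J, T.K n m * (T.E m z.2 * Real.exp (T.opH q m * s) * (A m + s * B m)) -
        (dir timeDir (dir timeDir (uncurry (v.2 n))) z +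
          s * dir (fieldDir q) (dir timeDir (dir timeDir (uncurry (v.2 n)))) z)) := by
    intro s
    have h := lattice_hasSum_zero hv n (z + s • fieldDir q)
    have hcol : ∀ m, dir (fieldDir (T.col m)) (uncurry (v.2 n)) (z + s • fieldDir q) =
        dir (fieldDir (T.col m)) (uncurry (v.2 n)) z := fun m =>
      (hf.dir _).eq_of_dir_eq_zero (lattice_dir_dir_field_coeff hv n q _) z s
    have hτe : dir timeDir (uncurry (v.1 0)) (z + s • fieldDir q) =
        dir timeDir (uncurry (v.1 0)) z :=
      (hτ.dir _).eq_of_dir_eq_zero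
        (by rw [hτ.dir_comm, lattice_dir_time_coeff hv, dir_zero_fun]) z s
    have hee : dir (fieldDir q) (dir (fieldDir q)
        (dir timeDir (dir timeDir (uncurry (v.2 n))))) = 0 := by
      rw [(hf.dir _).dir_comm (fieldDir q) timeDir, hf.dir_comm (fieldDir q) timeDir,
        ((hf.dir _).dir _).dir_comm (fieldDir q) timeDir, (hf.dir _).dir_comm (fieldDir q) timeDir,
        lattice_dir_dir_field_coeff hv, dir_zero_fun, dir_zero_fun]
    refine hasSum_of_eq h (fun m => ?_) ?_
    · rw [hz, E_add_smul, hcol, hτe]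
    · rw [((hf.dir _).dir _).eq_add_of_dir_dir_eq_zero hee z s, applyF_eq]
      congr 1
      rw [← Finset.sum_subset (Finset.subset_union_right : I ⊆ J)
        (fun m _ hm => by rw [T.K_eq_zero_of_notMem hm, zero_mul])]
      refine Finset.sum_congr rfl fun m _ => ?_
      rw [← lattice_opH_add hv m z q s, hz, E_add_smul]
      rfl
  -- Subtracting the condition at s = 0 makes the series finite: outside J the exponents do not
  -- change along q, so those terms cancel.
  have hdiff : ∀ s : ℝ, ∑ m ∈ J, (T.E m z.2 * Real.exp (T.opH q m * s) * a m -
      T.E m z.2 * Real.exp (T.opH q m * 0) * a m) = _ := fun s =>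
    (hasSum_sum_of_ne_finset_zero (s := J) fun m hm => by
      rw [hJ₀ m fun h => hm (Finset.mem_union_left _ h)]; simp).unique ((hline s).sub (hline 0))
  have hx := (exp_affine_coeff_eq_zero_of_eq_affine J (fun m => T.opH q m)
    (fun m => T.E m z.2 * (a m - T.K n m * A m)) (fun m => - (T.E m z.2 * (T.K n m * B m)))
    (∑ m ∈ J, T.E m z.2 * a m - ∑ m ∈ J, T.K n m * (T.E m z.2 * A m))
    (- dir (fieldDir q) (dir timeDir (dir timeDir (uncurry (v.2 n)))) z)
    m₀ hm₀ hq0 hq (fun s => by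
      have h := hdiff s
      rw [Finset.sum_sub_distrib] at h
      simp only [mul_zero, Real.exp_zero, mul_one, zero_mul, add_zero] at h
      have e : ∑ m ∈ J, Real.exp (T.opH q m * s) * (T.E m z.2 * (a m - T.K n m * A m) +
          - (T.E m z.2 * (T.K n m * B m)) * s) =
          ∑ m ∈ J, T.E m z.2 * Real.exp (T.opH q m * s) * a m -
          ∑ m ∈ J, T.K n m * (T.E m z.2 * Real.exp (T.opH q m * s) * (A m + s * B m)) := by
        rw [← Finset.sum_sub_distrib]
        exact Finset.sum_congr rfl fun m _ => by ring
      rw [e]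
      linear_combination h)).1
  have := (mul_eq_zero.1 hx).resolve_left (T.E_pos _ _).ne'
  linarith

/-- In `lattice_exp_coeff` the left side does not change along field directions, so neither does Hφ.
The row m + q₂ is chosen because its entry of K in column m is nonzero. -/
theorem lattice_opH_linear (hv : v ∈ T.latticeSymmetries) (p : Config) (m : ℤ)
    (z : (Fin 1 → ℝ) × Config) :
    T.opH (fun n => dir (fieldDir p) (uncurry (v.2 n)) z) m = 0 := by
  have hτ := (hv.1.1 0).finSmooth
  have hf := (hv.1.2 (m + T.q₂)).finSmooth
  have h0 := lattice_exp_coeff hv (m + T.q₂) m z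
  have h1 := lattice_exp_coeff hv (m + T.q₂) m (z + (1 : ℝ) • fieldDir p)
  rw [lattice_opH_add hv, (hf.dir _).eq_of_dir_eq_zero (lattice_dir_dir_field_coeff hv _ p _),
    (hτ.dir timeDir).eq_of_dir_eq_zero
      (by rw [hτ.dir_comm, lattice_dir_time_coeff hv, dir_zero_fun])] at h1
  have : T.K (m + T.q₂) m * T.opH (fun n => dir (fieldDir p) (uncurry (v.2 n)) z) m = 0 := by
    linarith
  exact (mul_eq_zero.1 this).resolve_left (T.K_right m)

/-- By `lattice_exp_coeff` the derivative of φ along column m is the multiple 2τ' + (Hφ)_m of that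
same column. H kills the derivative but not the column, so the factor vanishes. -/
theorem lattice_opH_field_coeff (hv : v ∈ T.latticeSymmetries) (m : ℤ)
    (z : (Fin 1 → ℝ) × Config) :
    T.opH (fun n => uncurry (v.2 n) z) m = -2 * dir timeDir (uncurry (v.1 0)) z := by
  set j := m + T.q₂ - T.p₁
  have h := lattice_opH_linear hv (T.col m) j z
  have e : (fun n => dir (fieldDir (T.col m)) (uncurry (v.2 n)) z) =
      (2 * dir timeDir (uncurry (v.1 0)) z + T.opH (fun n => uncurry (v.2 n) z) m) •
        (T.col m : ℤ → ℝ) := by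
    funext n
    have := lattice_exp_coeff hv n m z
    rw [Pi.smul_apply, smul_eq_mul, col_apply]
    linarith
  rw [e, opH_smul] at h
  have := (mul_eq_zero.1 h).resolve_right (T.opH_col_ne_zero m)
  linarith

theorem lattice_dir_col (hv : v ∈ T.latticeSymmetries) (n m : ℤ) (z : (Fin 1 → ℝ) × Config) :
    dir (fieldDir (T.col m)) (uncurry (v.2 n)) z = 0 := by
  have h := lattice_exp_coeff hv n m z
  rw [lattice_opH_field_coeff hv] at h
  linarith

/-- With Hφ = -2τ' and φ constant along the columns of K, all exponential terms cancel and only φ_tt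
is left. -/
theorem lattice_dir_time_dir_time_field_coeff (hv : v ∈ T.latticeSymmetries) (n : ℤ) :
    dir timeDir (dir timeDir (uncurry (v.2 n))) = 0 := by
  funext z
  have h := lattice_hasSum_zero hv n z
  have h2 := T.hasSum_K_mul n (fun m => T.E m z.2 * T.opH (fun k => v.2 k z.1 z.2) m)
  rw [← applyF_eq] at h2
  have h3 := h.unique (hasSum_of_eq h2 (fun m => by
    have := lattice_opH_field_coeff hv m z
    unfold uncurry at this
    rw [this, lattice_dir_col hv]
    unfold uncurry
    ring) rfl)
  simp only [Pi.zero_apply]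
  linarith

/-- ∂_q φ_n is affine in t with slope q_n τ''/2. Since H kills it at two times, τ'' Hq = 0; a q with
(Hq)_0 ≠ 0 gives τ'' = 0. -/
theorem lattice_dir_time_dir_field_coeff_eq_zero (hv : v ∈ T.latticeSymmetries) (n : ℤ)
    (q : Config) : dir timeDir (dir (fieldDir q) (uncurry (v.2 n))) = 0 := by
  have hf := fun n => (hv.1.2 n).finSmooth
  have hτ : dir timeDir (dir timeDir (uncurry (v.1 0))) = 0 := by
    funext z
    obtain ⟨q, hq, -⟩ := T.exists_separating 0
    have h0 := lattice_opH_linear hv q 0 z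
    have h1 := lattice_opH_linear hv q 0 (z + (1 : ℝ) • timeDir)
    have hee : ∀ n, dir timeDir (dir timeDir (dir (fieldDir q) (uncurry (v.2 n)))) = 0 := by
      intro n
      rw [(hf n).dir_comm timeDir (fieldDir q), ((hf n).dir _).dir_comm timeDir (fieldDir q),
        lattice_dir_time_dir_time_field_coeff hv, dir_zero_fun]
    have e : (fun n => dir (fieldDir q) (uncurry (v.2 n)) (z + (1 : ℝ) • timeDir)) =
        (fun n => dir (fieldDir q) (uncurry (v.2 n)) z) +
          (dir timeDir (dir timeDir (uncurry (v.1 0))) z / 2) • (q : ℤ → ℝ) := by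
      funext n
      rw [((hf n).dir _).eq_add_of_dir_dir_eq_zero (hee n)]
      have := lattice_dir_time_dir_field_coeff hv n q z
      simp only [Pi.add_apply, Pi.smul_apply, smul_eq_mul]
      linarith
    rw [e, opH_add, h0, opH_smul, zero_add] at h1
    have := (mul_eq_zero.1 h1).resolve_right hq
    simp only [Pi.zero_apply]
    linarith
  funext z
  have h := lattice_dir_time_dir_field_coeff hv n q z
  rw [hτ] at h
  simpa using h

theorem lattice_eq_affineVF (hv : v ∈ T.latticeSymmetries) :
    ∃ b a α β γ, T.IsCompatible a α β γ ∧ v = affineVF b a α β γ := by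
  have hτ := (hv.1.1 0).finSmooth
  have hf := fun n => (hv.1.2 n).finSmooth
  have hτee : dir timeDir (dir timeDir (uncurry (v.1 0))) = 0 := by
    funext z
    have := lattice_dir_time_dir_field_coeff hv 0 (Finsupp.single 0 1) z
    rw [lattice_dir_time_dir_field_coeff_eq_zero hv] at this
    simpa using this.symm
  -- Every point is reached from the origin by a time segment followed by a field segment; the
  -- coefficients are affine on each.
  have hpt : ∀ (t : Fin 1 → ℝ) (u : Config),
      ((t, u) : (Fin 1 → ℝ) × Config) = (0 + t 0 • timeDir) + (1 : ℝ) • fieldDir u := by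
    intro t u
    refine Prod.ext ?_ ?_
    · funext i
      have : i = 0 := Subsingleton.elim _ _
      subst this
      simp [timeDir, fieldDir]
    · simp [timeDir, fieldDir]
  let γ : ℤ → Config →ₗ[ℝ] ℝ := fun n =>
    { toFun := fun u => dir (fieldDir u) (uncurry (v.2 n)) 0
      map_add' := fun u w => by rw [fieldDir_add, (hf n).dir_add]; rfl
      map_smul' := fun c u => by rw [fieldDir_smul, dir_smul]; rfl }
  refine ⟨uncurry (v.1 0) 0, dir timeDir (uncurry (v.1 0)) 0, fun n => uncurry (v.2 n) 0,
    fun n => dir timeDir (uncurry (v.2 n)) 0, γ, ⟨fun m => lattice_opH_field_coeff hv m 0, ?_,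
      fun u m => lattice_opH_linear hv u m 0, fun n m => lattice_dir_col hv n m 0⟩, ?_⟩
  · intro m
    have h1 := lattice_opH_field_coeff hv m (0 + (1 : ℝ) • timeDir)
    have e : (fun n => uncurry (v.2 n) (0 + (1 : ℝ) • timeDir)) =
        (fun n => uncurry (v.2 n) 0) + fun n => dir timeDir (uncurry (v.2 n)) 0 := by
      funext n
      rw [(hf n).eq_add_of_dir_dir_eq_zero (lattice_dir_time_dir_time_field_coeff hv n), one_mul]
      rfl
    rw [e, opH_add, lattice_opH_field_coeff hv, (hτ.dir _).eq_of_dir_eq_zero hτee] at h1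
    linarith
  · refine Prod.ext ?_ ?_
    · funext i t u
      have : i = 0 := Subsingleton.elim _ _
      subst this
      change uncurry (v.1 0) (t, u) = _
      rw [hpt, hτ.eq_of_dir_eq_zero (lattice_dir_time_coeff hv u),
        hτ.eq_add_of_dir_dir_eq_zero hτee]
      simp only [affineVF]
      ring
    · funext n t u
      change uncurry (v.2 n) (t, u) = _
      rw [hpt, lattice_field_coeff_add hv,
        ((hf n).dir _).eq_of_dir_eq_zero (lattice_dir_time_dir_field_coeff_eq_zero hv n u),
        (hf n).eq_add_of_dir_dir_eq_zero (lattice_dir_time_dir_time_field_coeff hv n)]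
      simp [affineVF, γ]

end Lattice

end BandData

theorem FinSmooth.comp_linear {V V' : Type*} [AddCommGroup V] [Module ℝ V] [AddCommGroup V']
    [Module ℝ V'] {f : V' → ℝ} (hf : FinSmooth f) (π : V →ₗ[ℝ] V') :
    FinSmooth (fun z => f (π z)) := by
  intro W _ _ _ L z
  simpa using hf W (π.comp L) (π z)

theorem dir_comp_linear {V V' : Type*} [AddCommGroup V] [Module ℝ V] [AddCommGroup V']
    [Module ℝ V'] (f : V' → ℝ) (π : V →ₗ[ℝ] V') (w : V) :
    dir w (fun z => f (π z)) = fun z => dir (π w) f (π z) :=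
  funext fun z => lineDeriv_comp_linear π f z w

theorem dir_affine {V : Type*} [AddCommGroup V] [Module ℝ V] (c : ℝ) (l : V →ₗ[ℝ] ℝ) (w : V) :
    dir w (fun z => c + l z) = fun _ => l w :=
  funext fun z => lineDeriv_affine c l z w

/-! ### Reduction of the symmetries of the field theory -/

/-- The direction with independent components `∂_{x_i}` and field components `q`. -/
noncomputable def jetDir (i : Fin 2) (q : Config) : (Fin 2 → ℝ) × Config := (Pi.single i 1, q)

/-- A direction in the space of fields. -/
noncomputable def vertDir (q : Config) : (Fin 2 → ℝ) × Config := (0, q)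

theorem jetDir_eq (i : Fin 2) (q : Config) : jetDir i q = jetDir i 0 + vertDir q := by
  simp [jetDir, vertDir]

theorem translation_fst (i : Fin 2) : ∃ c : ℝ, translation.1 i = fun _ _ => c := by
  fin_cases i
  · exact ⟨1, rfl⟩
  · exact ⟨-1, rfl⟩

theorem applyVF_const {p : ℕ} (X : VF p) (c : ℝ) (x : Fin p → ℝ) (u : Config) :
    applyVF X (fun _ _ => c) x u = 0 := by
  simp [applyVF, partialX, partialU]

theorem applyVF_translation (f : Fun 2) (x : Fin 2 → ℝ) (u : Config) :
    applyVF translation f x u =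
      dir (jetDir 0 0) (uncurry f) (x, u) - dir (jetDir 1 0) (uncurry f) (x, u) := by
  simp [applyVF, translation, partialX_eq, dir, jetDir, sub_eq_add_neg]

theorem bracket_translation_fst (X : VF 2) (i : Fin 2) (x : Fin 2 → ℝ) (u : Config) :
    (bracket X translation).1 i x u = dir (jetDir 1 0) (uncurry (X.1 i)) (x, u) -
      dir (jetDir 0 0) (uncurry (X.1 i)) (x, u) := by
  obtain ⟨c, hc⟩ := translation_fst i
  have : (bracket X translation).1 i x u =
    applyVF X (translation.1 i) x u - applyVF translation (X.1 i) x u := rfl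
  rw [this, hc, applyVF_const, applyVF_translation]
  ring

theorem bracket_translation_snd (X : VF 2) (n : ℤ) (x : Fin 2 → ℝ) (u : Config) :
    (bracket X translation).2 n x u = dir (jetDir 1 0) (uncurry (X.2 n)) (x, u) -
      dir (jetDir 0 0) (uncurry (X.2 n)) (x, u) := by
  have : (bracket X translation).2 n x u =
    applyVF X (fun _ _ => 0) x u - applyVF translation (X.2 n) x u := rfl
  rw [this, applyVF_const, applyVF_translation]
  ring

/-- The projection `(x, y, u) ↦ (x + y, u)`. -/
noncomputable def reduction : (Fin 2 → ℝ) × Config →ₗ[ℝ] (Fin 1 → ℝ) × Config where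
  toFun z := (fun _ => z.1 0 + z.1 1, z.2)
  map_add' z w := by
    refine Prod.ext (funext fun _ => ?_) rfl
    simp; ring
  map_smul' c z := by
    refine Prod.ext (funext fun _ => ?_) rfl
    simp; ring

/-- The section `(t, u) ↦ (t, 0, u)` of the projection. -/
noncomputable def reductionSection : (Fin 1 → ℝ) × Config →ₗ[ℝ] (Fin 2 → ℝ) × Config where
  toFun z := (![z.1 0, 0], z.2)
  map_add' z w := by
    refine Prod.ext (funext fun i => ?_) rfl
    fin_cases i <;> simp
  map_smul' c z := by
    refine Prod.ext (funext fun i => ?_) rfl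
    fin_cases i <;> simp

theorem reduction_section (z : (Fin 1 → ℝ) × Config) : reduction (reductionSection z) = z := by
  refine Prod.ext (funext fun i => ?_) rfl
  have : i = 0 := Subsingleton.elim _ _
  subst this
  simp [reduction, reductionSection]

namespace BandData

variable {T : BandData}

theorem reduction_jetDir (i : Fin 2) (q : Config) :
    reduction (jetDir i q) = timeDir + fieldDir q := by
  rw [timeDir_add_fieldDir]
  refine Prod.ext (funext fun j => ?_) rfl
  have : j = 0 := Subsingleton.elim _ _
  subst this
  fin_cases i <;> simp [reduction, jetDir]

theorem reduction_vertDir (q : Config) : reduction (vertDir q) = fieldDir q := by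
  refine Prod.ext (funext fun j => ?_) rfl
  simp [reduction, vertDir, fieldDir]

/-! ### From the field theory to the lattice -/

theorem onShell_field_iff {X : VF 2} (hX : SmoothVF X) (n : ℤ) (x : Fin 2 → ℝ) (u : Config)
    (u1 : Fin 2 → Config) (a b : Config) :
    T.OnShell u (fun w => prolong2 X n 0 1 x u u1 ![![a, w], ![w, b]] - T.applyF X n x u) 0 ↔
    HasSum (fun m => T.E m u * (dir (vertDir (T.col m)) (uncurry (X.2 n)) (x, u)
        - T.K n m * (dir (jetDir 0 (u1 0)) (uncurry (X.1 0)) (x, u) +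
          dir (jetDir 1 (u1 1)) (uncurry (X.1 1)) (x, u))
        - u1 0 n * dir (vertDir (T.col m)) (uncurry (X.1 0)) (x, u)
        - u1 1 n * dir (vertDir (T.col m)) (uncurry (X.1 1)) (x, u)))
      (T.applyF X n x u - dir (jetDir 1 (u1 1)) (dir (jetDir 0 (u1 0)) (uncurry (X.2 n))) (x, u)
        + u1 0 n * dir (jetDir 1 (u1 1)) (dir (jetDir 0 (u1 0)) (uncurry (X.1 0))) (x, u)
        + u1 1 n * dir (jetDir 1 (u1 1)) (dir (jetDir 0 (u1 0)) (uncurry (X.1 1))) (x, u)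
        + b n * dir (jetDir 0 (u1 0)) (uncurry (X.1 1)) (x, u)
        + a n * dir (jetDir 1 (u1 1)) (uncurry (X.1 0)) (x, u)) := by
  unfold OnShell
  simp only [prolong2_eq hX, Fin.sum_univ_two, Fin.isValue, Matrix.cons_val_zero,
    Matrix.cons_val_one, col_apply, Finsupp.coe_zero, Pi.zero_apply, zero_mul]
  have h0 : ((0, 0) : (Fin 2 → ℝ) × Config) = 0 := rfl
  rw [h0]
  simp only [lineDeriv_zero]
  unfold dir jetDir vertDir
  constructor <;> intro h <;> refine hasSum_of_eq h (fun m => ?_) ?_ <;> ring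

/-- In the symmetries of the field theory, the coefficient of `∂_x` depends on `x` only and that
of `∂_y` depends on `y` only. -/
theorem field_dir_eq_zero {X : VF 2} (hX : X ∈ T.fieldSymmetries) (q : Config) :
    dir (jetDir 0 q) (uncurry (X.1 1)) = 0 ∧ dir (jetDir 1 q) (uncurry (X.1 0)) = 0 := by
  -- The condition is compared for arbitrary u_xx, u_yy and for zero ones; only the terms D_x η and
  -- D_y ξ carry them.
  have key : ∀ (z : (Fin 2 → ℝ) × Config) (a b : Config),
      b 0 * dir (jetDir 0 q) (uncurry (X.1 1)) z +
        a 0 * dir (jetDir 1 q) (uncurry (X.1 0)) z = 0 := by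
    intro z a b
    have h1 := (onShell_field_iff hX.1 0 z.1 z.2 _ a b).1 (hX.2 0 z.1 z.2 (fun _ => q) a b)
    have h2 := (onShell_field_iff hX.1 0 z.1 z.2 _ 0 0).1 (hX.2 0 z.1 z.2 (fun _ => q) 0 0)
    have h3 := h1.unique h2
    simp only [Finsupp.coe_zero, Pi.zero_apply, zero_mul, add_zero, Prod.mk.eta] at h3
    linarith
  constructor
  · funext z
    simpa using key z 0 (Finsupp.single 0 1)
  · funext z
    simpa using key z (Finsupp.single 0 1) 0

theorem inheritedSymmetries_subset : T.inheritedSymmetries ⊆ T.latticeSymmetries := by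
  rintro v ⟨X, ⟨hX, c, hc⟩, hA⟩
  have hξ := (hX.1.1 0).finSmooth
  have hη := (hX.1.1 1).finSmooth
  have hsum : (fun z => uncurry (v.1 0) (reduction z)) = uncurry (X.1 0) + uncurry (X.1 1) :=
    funext fun z => (hA z.1 z.2).1.symm
  have hfield : ∀ n, (fun z => uncurry (v.2 n) (reduction z)) = uncurry (X.2 n) :=
    fun n => funext fun z => ((hA z.1 z.2).2 n).symm
  -- Smoothness descends along the projection because the latter has a linear section.
  have hsec : ∀ f : (Fin 1 → ℝ) × Config → ℝ,
      FinSmooth (fun z => f (reduction z)) → FinSmooth f := by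
    intro f hf
    have := hf.comp_linear reductionSection
    simpa only [reduction_section] using this
  have hv : SmoothVF v := by
    constructor
    · intro i
      have : i = 0 := Subsingleton.elim _ _
      subst this
      refine FinSmooth.smoothFun (hsec _ ?_)
      rw [hsum]
      exact hξ.add hη
    · intro n
      refine FinSmooth.smoothFun (hsec _ ?_)
      rw [hfield]
      exact (hX.1.2 n).finSmooth
  have hvert0 : ∀ q, dir (vertDir q) (uncurry (X.1 0)) = 0 := by
    intro q
    have h := (field_dir_eq_zero hX q).2
    rwa [jetDir_eq, hξ.dir_add, (field_dir_eq_zero hX 0).2, zero_add] at h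
  have hvert1 : ∀ q, dir (vertDir q) (uncurry (X.1 1)) = 0 := by
    intro q
    have h := (field_dir_eq_zero hX q).1
    rwa [jetDir_eq, hη.dir_add, (field_dir_eq_zero hX 0).1, zero_add] at h
  have hξx : ∀ q, dir (jetDir 0 q) (uncurry (X.1 0)) = fun _ => -c := by
    intro q
    rw [jetDir_eq, hξ.dir_add, hvert0, add_zero]
    funext z
    have h := bracket_translation_fst X 0 z.1 z.2
    rw [hc, Prod.mk.eta, (field_dir_eq_zero hX 0).2] at h
    have e : (c • translation).1 0 z.1 z.2 = c * 1 := rfl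
    rw [e] at h
    simp only [Pi.zero_apply] at h
    linarith
  have hηy : ∀ q, dir (jetDir 1 q) (uncurry (X.1 1)) = fun _ => -c := by
    intro q
    rw [jetDir_eq, hη.dir_add, hvert1, add_zero]
    funext z
    have h := bracket_translation_fst X 1 z.1 z.2
    rw [hc, Prod.mk.eta, (field_dir_eq_zero hX 0).1] at h
    have e : (c • translation).1 1 z.1 z.2 = c * (-1) := rfl
    rw [e] at h
    simp only [Pi.zero_apply] at h
    linarith
  refine ⟨hv, fun n t u u1 => ?_⟩
  obtain ⟨q, rfl⟩ : ∃ q : Config, u1 = fun _ => q :=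
    ⟨u1 0, funext fun i => congrArg u1 (Subsingleton.elim _ _)⟩
  rw [onShell_lattice_iff hv]
  set x : Fin 2 → ℝ := ![t 0, 0] with hx
  have hz : reduction (x, u) = (t, u) := reduction_section (t, u)
  -- First derivatives are taken equal, as for functions of x + y. The second derivatives u_xx, u_yy
  -- may be set to zero since their coefficients vanish.
  have h := (onShell_field_iff hX.1 n x u _ 0 0).1 (hX.2 n x u (fun _ => q) 0 0)
  have hτ : ∀ w, dir (reduction w) (uncurry (v.1 0)) (t, u) =
      dir w (uncurry (X.1 0)) (x, u) + dir w (uncurry (X.1 1)) (x, u) := by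
    intro w
    rw [← hz, ← Pi.add_apply, ← dir_add_fun hξ hη, ← hsum, dir_comp_linear]
  have hτ2 : dir (timeDir + fieldDir q) (dir (timeDir + fieldDir q) (uncurry (v.1 0))) (t, u) =
      0 := by
    have e : dir (jetDir 0 q) (dir (jetDir 0 q) (fun z => uncurry (v.1 0) (reduction z))) =
        0 := by
      rw [hsum, dir_add_fun hξ hη, hξx, (field_dir_eq_zero hX q).1, add_zero, dir_const]
    rw [dir_comp_linear, dir_comp_linear (dir _ _), reduction_jetDir] at e
    have := congrFun e (x, u)
    rwa [hz] at this
  have hf2 : dir (timeDir + fieldDir q) (dir (timeDir + fieldDir q) (uncurry (v.2 n))) (t, u) =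
      dir (jetDir 1 q) (dir (jetDir 0 q) (uncurry (X.2 n))) (x, u) := by
    rw [← hfield, dir_comp_linear, dir_comp_linear (dir _ _), reduction_jetDir, reduction_jetDir]
    exact congrArg _ hz.symm
  have hf1 : ∀ p, dir (fieldDir p) (uncurry (v.2 n)) (t, u) =
      dir (vertDir p) (uncurry (X.2 n)) (x, u) := by
    intro p
    rw [← hfield, dir_comp_linear, reduction_vertDir]
    exact congrArg _ hz.symm
  have hF : T.applyF v n t u = T.applyF X n x u := by
    have e : ∀ m, X.2 m x u = v.2 m t u := by
      intro m
      have h := congrFun (hfield m) (x, u)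
      rw [hz] at h
      exact h.symm
    unfold applyF
    simp only [e]
  have hτ1 : dir (timeDir + fieldDir q) (uncurry (v.1 0)) (t, u) = -c := by
    rw [← reduction_jetDir 0, hτ, hξx, (field_dir_eq_zero hX q).1]; simp
  have hτv : ∀ p, dir (fieldDir p) (uncurry (v.1 0)) (t, u) = 0 := by
    intro p
    rw [← reduction_vertDir, hτ, hvert0, hvert1]; simp
  refine hasSum_of_eq h (fun m => ?_) ?_
  · rw [hτ1, hτv, hf1]
    simp only [hξx, hηy, hvert0, hvert1, Pi.zero_apply]
    ring
  · rw [hτ2, hf2, hF]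
    simp only [hξx, (field_dir_eq_zero hX q).1, (field_dir_eq_zero hX q).2, dir_const,
      dir_zero_fun, Pi.zero_apply]
    ring

/-! ### Lifting affine fields to the field theory -/

theorem affineVF_mem_inheritedSymmetries {a : ℝ} {α β : ℤ → ℝ} {γ : ℤ → Config →ₗ[ℝ] ℝ}
    (h : T.IsCompatible a α β γ) (b : ℝ) : affineVF b a α β γ ∈ T.inheritedSymmetries := by
  -- The scaling a t splits as a x + a y, with the same slope in both variables so that X normalizes
  -- ∂_x - ∂_y; the constant b may be placed entirely in x.
  let X : VF 2 := (![fun x _ => b + a * x 0, fun x _ => a * x 1],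
    fun n x u => α n + (x 0 + x 1) * β n + γ n u)
  let coord : Fin 2 → ((Fin 2 → ℝ) × Config →ₗ[ℝ] ℝ) := fun i =>
    (LinearMap.proj i).comp (LinearMap.fst ℝ _ _)
  let l : ℤ → ((Fin 2 → ℝ) × Config →ₗ[ℝ] ℝ) := fun n =>
    β n • (coord 0 + coord 1) + (γ n).comp (LinearMap.snd ℝ _ _)
  have e0 : uncurry (X.1 0) = fun z => b + (a • coord 0) z := rfl
  have e1 : uncurry (X.1 1) = fun z => 0 + (a • coord 1) z := funext fun z => (zero_add _).symm
  have e2 : ∀ n, uncurry (X.2 n) = fun z => α n + l n z := by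
    intro n
    funext z
    simp [X, l, coord, uncurry]
    ring
  have hX : SmoothVF X := by
    refine ⟨fun i => FinSmooth.smoothFun ?_, fun n => FinSmooth.smoothFun ?_⟩
    · fin_cases i
      · exact (FinSmooth.const b).add (FinSmooth.linear (a • coord 0))
      · change FinSmooth (uncurry (X.1 1))
        rw [e1]
        exact (FinSmooth.const 0).add (FinSmooth.linear (a • coord 1))
    · rw [e2]
      exact (FinSmooth.const _).add (FinSmooth.linear _)
  refine ⟨X, ⟨⟨hX, fun n x u u1 a' b' => ?_⟩, -a, ?_⟩, fun x u => ⟨?_, fun n => rfl⟩⟩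
  · rw [onShell_field_iff hX, applyF_eq]
    -- Both sides are -2a F_n: one from rescaling the second derivatives, the other from Hφ = -2a.
    refine hasSum_of_eq (T.hasSum_K_mul n (fun m => T.E m u * (-2 * a))) (fun m => ?_) ?_
    · simp only [e0, e1, e2, dir_affine]
      simp [l, coord, jetDir, vertDir, h.linear_col]
      ring
    · simp only [e0, e1, e2, dir_affine, dir_const]
      have hop : ∀ m, T.opH (fun k => X.2 k x u) m = -2 * a := by
        intro m
        have e : (fun k => X.2 k x u) = (α + (x 0 + x 1) • β) + fun k => γ k u := rfl
        rw [e, opH_add, opH_add, opH_smul, h.opH_const, h.opH_slope, h.opH_linear]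
        ring
      simp only [hop]
      simp [coord, jetDir]
  · refine Prod.ext (funext fun i => funext fun x => funext fun u => ?_)
      (funext fun n => funext fun x => funext fun u => ?_)
    · rw [bracket_translation_fst]
      fin_cases i
      · change dir _ (uncurry (X.1 0)) _ - dir _ (uncurry (X.1 0)) _ = -a * 1
        rw [e0]
        simp only [dir_affine]
        simp [coord, jetDir]
      · change dir _ (uncurry (X.1 1)) _ - dir _ (uncurry (X.1 1)) _ = -a * -1
        rw [e1]
        simp only [dir_affine]
        simp [coord, jetDir]
    · rw [bracket_translation_snd]
      change _ = -a * 0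
      simp only [e2, dir_affine]
      simp [l, coord, jetDir]
  · simp [X, affineVF]
    ring

end BandData

/-! ### The span of the generators -/

theorem affineVF_eq_zero {b a : ℝ} {α β : ℤ → ℝ} {γ : ℤ → Config →ₗ[ℝ] ℝ}
    (h : affineVF b a α β γ = 0) :
    b = 0 ∧ a = 0 ∧ (∀ n, α n = 0) ∧ (∀ n, β n = 0) ∧ ∀ n u, γ n u = 0 := by
  have h1 : ∀ t : Fin 1 → ℝ, b + a * t 0 = 0 := fun t =>
    congrFun (congrFun (congrFun (congrArg Prod.fst h) 0) t) 0
  have h2 : ∀ n (t : Fin 1 → ℝ) u, α n + t 0 * β n + γ n u = 0 := fun n t u =>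
    congrFun (congrFun (congrFun (congrArg Prod.snd h) n) t) u
  have hb : b = 0 := by simpa using h1 0
  have ha : a = 0 := by simpa [hb] using h1 1
  have hα : ∀ n, α n = 0 := fun n => by simpa using h2 n 0 0
  have hβ : ∀ n, β n = 0 := fun n => by simpa [hα] using h2 n 1 0
  exact ⟨hb, ha, hα, hβ, fun n u => by simpa [hα] using h2 n 0 u⟩

/-- In this normal form the five coefficients of an affine field separate the types P, D, U, W, Z,
which serves both independence and spanning. -/
theorem sum_smul_generators {r s : ℕ} (ρ : ℤ → ℝ) (ψ : Fin r → ℤ → ℝ) (φ : Fin s → ℤ → ℝ)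
    (c : (Unit ⊕ Unit) ⊕ (Fin r ⊕ Fin r) ⊕ (Fin r × Fin s) → ℝ) :
    ∑ i, c i • generators ρ ψ φ i =
      affineVF (c (.inl (.inl ()))) (c (.inl (.inr ())))
        (fun n => c (.inl (.inr ())) * (-2 * ρ n) + ∑ j, c (.inr (.inl (.inl j))) * ψ j n)
        (fun n => ∑ j, c (.inr (.inl (.inr j))) * ψ j n)
        (fun n => ∑ j, ∑ l, (c (.inr (.inr (j, l))) * ψ j n) •
          Finsupp.linearCombination ℝ (φ l)) := by
  simp only [Fintype.sum_sum_type, Fintype.sum_prod_type, Finset.univ_unique,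
    Finset.sum_singleton]
  refine Prod.ext (funext fun i => funext fun t => funext fun u => ?_)
    (funext fun n => funext fun t => funext fun u => ?_)
  · simp [generators, genP, genD, genU, genW, genZ, affineVF, Prod.fst_sum, Finset.sum_apply]
  · simp [generators, genP, genD, genU, genW, genZ, affineVF, Prod.snd_sum, Finset.sum_apply,
      Finsupp.linearCombination_apply, Finset.mul_sum]
    have e1 : ∀ j, c (.inr (.inl (.inr j))) * (t 0 * ψ j n) =
      t 0 * (c (.inr (.inl (.inr j))) * ψ j n) := fun j => by ring
    have e2 : ∀ j l, c (.inr (.inr (j, l))) * ((u.sum fun m a => φ l m * a) * ψ j n) =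
      c (.inr (.inr (j, l))) * ψ j n * u.sum fun m a => a * φ l m := fun j l => by
        simp only [mul_comm (φ l _)]
        ring
    simp only [e1, e2]
    ring

namespace BandData

variable (T : BandData)

theorem opH_linearCombination {r : ℕ} {ψ : Fin r → ℤ → ℝ} (hψ : ∀ j n, T.opH (ψ j) n = 0)
    (x : Fin r → ℝ) (m : ℤ) : T.opH (fun n => ∑ j, x j * ψ j n) m = 0 := by
  rw [opH_sum]
  refine Finset.sum_eq_zero fun j _ => ?_
  have : (fun n => x j * ψ j n) = x j • ψ j := rfl
  rw [this, opH_smul, hψ, mul_zero]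

theorem linearCombination_col (φ : ℤ → ℝ) (m : ℤ) :
    Finsupp.linearCombination ℝ φ (T.col m) = T.opK φ m := by
  rw [T.linear_col]
  simp

variable {T}

theorem eq_zero_of_sum_mul_eq_zero {r : ℕ} {ψ : Fin r → ℤ → ℝ} (hi : LinearIndependent ℝ ψ)
    {x : Fin r → ℝ} (h : ∀ n, ∑ j, x j * ψ j n = 0) (j : Fin r) : x j = 0 :=
  Fintype.linearIndependent_iff.1 hi x (funext fun n => by simpa [Finset.sum_apply] using h n) j

theorem linearIndependent_generators {r s : ℕ} (ρ : ℤ → ℝ) {ψ : Fin r → ℤ → ℝ}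
    {φ : Fin s → ℤ → ℝ} (hψ : LinearIndependent ℝ ψ) (hφ : LinearIndependent ℝ φ) :
    LinearIndependent ℝ (generators ρ ψ φ) := by
  rw [Fintype.linearIndependent_iff]
  intro c hc
  rw [sum_smul_generators] at hc
  obtain ⟨hP, hD, hU, hW, hZ⟩ := affineVF_eq_zero hc
  have hU' := eq_zero_of_sum_mul_eq_zero hψ (fun n => by simpa [hD] using hU n)
  have hW' := eq_zero_of_sum_mul_eq_zero hψ hW
  -- The fields are tested on a single site k; independence of ψ and then of φ separates the two
  -- indices.
  have hZ' : ∀ j l, c (.inr (.inr (j, l))) = 0 := by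
    intro j
    refine eq_zero_of_sum_mul_eq_zero hφ fun k => ?_
    refine eq_zero_of_sum_mul_eq_zero hψ
      (x := fun j => ∑ l, c (.inr (.inr (j, l))) * φ l k) (fun n => ?_) j
    have := hZ n (Finsupp.single k 1)
    simp only [LinearMap.sum_apply, LinearMap.smul_apply, Finsupp.linearCombination_single,
      smul_eq_mul] at this
    rw [← this]
    refine Finset.sum_congr rfl fun j _ => ?_
    rw [Finset.sum_mul]
    exact Finset.sum_congr rfl fun l _ => by ring
  rintro ((⟨⟩ | ⟨⟩) | ((j | j) | ⟨j, l⟩))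
  exacts [hP, hD, hU' j, hW' j, hZ' j l]

/-- The compatibility conditions are linear recurrences: α + 2aρ and β lie in the kernel of H, and γ
lies in the kernel of H in its index n and in that of the transpose of K in its argument, a tensor
product spanned by the ψ^j φ^l. -/
theorem mem_span_generators_iff {ρ : ℤ → ℝ} (hρ : ∀ n, T.opH ρ n = 1)
    {ψ : Fin (T.p₂ - T.p₁).toNat → ℤ → ℝ} (hψ : ∀ j n, T.opH (ψ j) n = 0)
    (hψi : LinearIndependent ℝ ψ)
    {φ : Fin (T.q₂ - T.q₁).toNat → ℤ → ℝ} (hφ : ∀ l m, T.opK (φ l) m = 0)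
    (hφi : LinearIndependent ℝ φ) (v : VF 1) :
    v ∈ Submodule.span ℝ (Set.range (generators ρ ψ φ)) ↔
      ∃ b a α β γ, T.IsCompatible a α β γ ∧ v = affineVF b a α β γ := by
  rw [Submodule.mem_span_range_iff_exists_fun]
  constructor
  · rintro ⟨c, rfl⟩
    refine ⟨_, _, _, _, _, ⟨fun m => ?_, fun m => ?_, fun u m => ?_, fun n m => ?_⟩,
      sum_smul_generators ρ ψ φ c⟩
    · have e : (fun n => c (.inl (.inr ())) * (-2 * ρ n) +
          ∑ j, c (.inr (.inl (.inl j))) * ψ j n) = (c (.inl (.inr ())) * -2) • ρ +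
          fun n => ∑ j, c (.inr (.inl (.inl j))) * ψ j n := by
        funext n
        simp only [Pi.add_apply, Pi.smul_apply, smul_eq_mul]
        ring
      rw [e, opH_add, opH_smul, hρ, T.opH_linearCombination hψ]
      ring
    · exact T.opH_linearCombination hψ _ m
    · have e : (fun n => (∑ j, ∑ l, (c (.inr (.inr (j, l))) * ψ j n) •
          Finsupp.linearCombination ℝ (φ l)) u) = fun n => ∑ j,
          (∑ l, c (.inr (.inr (j, l))) * Finsupp.linearCombination ℝ (φ l) u) * ψ j n := by
        funext n
        simp only [LinearMap.sum_apply, LinearMap.smul_apply, smul_eq_mul, Finset.sum_mul]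
        exact Finset.sum_congr rfl fun j _ => Finset.sum_congr rfl fun l _ => by ring
      rw [e]
      exact T.opH_linearCombination hψ _ m
    · simp [LinearMap.sum_apply, linearCombination_col, hφ]
  · rintro ⟨b, a, α, β, γ, h, rfl⟩
    have span : ∀ f : ℤ → ℝ, (∀ n, T.opH f n = 0) → ∃ x : Fin (T.p₂ - T.p₁).toNat → ℝ,
        ∀ n, f n = ∑ j, x j * ψ j n :=
      fun f hf => exists_eq_sum_of_recurrence T.hp T.H_left T.H_right hψ hψi hf
    obtain ⟨cU, hU⟩ := span (α + (2 * a) • ρ) (fun n => by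
      rw [opH_add, opH_smul, hρ, h.opH_const]; ring)
    obtain ⟨cW, hW⟩ := span β h.opH_slope
    -- γ is expanded in ψ site by site of its argument; independence of ψ then turns γ_n(column m) =
    -- 0 into the K-recurrence for each coefficient sequence.
    choose g hg using fun k => span (fun n => γ n (Finsupp.single k 1)) (h.opH_linear _)
    have hgK : ∀ j m, T.opK (fun k => g k j) m = 0 := by
      intro j m
      refine eq_zero_of_sum_mul_eq_zero hψi (x := fun j => T.opK (fun k => g k j) m)
        (fun n => ?_) j
      have := h.linear_col n m
      rw [T.linear_col] at this
      rw [← this]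
      simp only [opK, hg, Finset.sum_mul, Finset.mul_sum]
      rw [Finset.sum_comm]
      exact Finset.sum_congr rfl fun _ _ => Finset.sum_congr rfl fun _ _ => by ring
    have hex : ∀ j, ∃ x : Fin (T.q₂ - T.q₁).toNat → ℝ, ∀ k, g k j = ∑ l, x l * φ l k := fun j =>
      exists_eq_sum_of_recurrence (f := fun k => g k j) T.hq (c := fun m σ => T.K (m + σ) m)
        T.K_left T.K_right hφ hφi (hgK j)
    choose cZ hZ using hex
    refine ⟨Sum.elim (Sum.elim (fun _ => b) (fun _ => a))
      (Sum.elim (Sum.elim cU cW) (fun jl => cZ jl.1 jl.2)), ?_⟩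
    rw [sum_smul_generators]
    simp only [Sum.elim_inl, Sum.elim_inr]
    congr 1
    · funext n
      rw [← hU]
      simp only [Pi.add_apply, Pi.smul_apply, smul_eq_mul]
      ring
    · funext n
      exact (hW n).symm
    · funext n
      refine Finsupp.lhom_ext' fun k => LinearMap.ext_ring ?_
      simp only [LinearMap.comp_apply, Finsupp.lsingle_apply, LinearMap.sum_apply,
        LinearMap.smul_apply, Finsupp.linearCombination_single, smul_eq_mul, hg, hZ,
        Finset.sum_mul]
      exact Finset.sum_congr rfl fun _ _ => Finset.sum_congr rfl fun _ _ => by ring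

end BandData

end GenToda

theorem theorem2 (T : GenToda.BandData)
    (ρ : ℤ → ℝ) (hρ : ∀ n, T.opH ρ n = 1)
    (ψ : Fin (T.p₂ - T.p₁).toNat → ℤ → ℝ) (hψ : ∀ j n, T.opH (ψ j) n = 0)
    (hψ_indep : LinearIndependent ℝ ψ)
    (φ : Fin (T.q₂ - T.q₁).toNat → ℤ → ℝ) (hφ : ∀ l m, T.opK (φ l) m = 0)
    (hφ_indep : LinearIndependent ℝ φ) :
    LinearIndependent ℝ (GenToda.generators ρ ψ φ) ∧
    T.inheritedSymmetries =
      (Submodule.span ℝ (Set.range (GenToda.generators ρ ψ φ)) : Set (GenToda.VF 1)) ∧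
    T.inheritedSymmetries = T.latticeSymmetries := by
  have hspan := GenToda.BandData.mem_span_generators_iff hρ hψ hψ_indep hφ hφ_indep
  have hlat : ∀ v ∈ T.latticeSymmetries, v ∈ T.inheritedSymmetries := by
    intro v hv
    obtain ⟨b, a, α, β, γ, h, rfl⟩ := GenToda.BandData.lattice_eq_affineVF hv
    exact GenToda.BandData.affineVF_mem_inheritedSymmetries h b
  refine ⟨GenToda.BandData.linearIndependent_generators ρ hψ_indep hφ_indep, ?_,
    Set.Subset.antisymm GenToda.BandData.inheritedSymmetries_subset hlat⟩
  ext v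
  rw [SetLike.mem_coe, hspan]
  constructor
  · exact fun hv =>
      GenToda.BandData.lattice_eq_affineVF (GenToda.BandData.inheritedSymmetries_subset hv)
  · rintro ⟨b, a, α, β, γ, h, rfl⟩
    exact GenToda.BandData.affineVF_mem_inheritedSymmetries h b
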